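/- All strings are over $\{0,1\}$; a language or oracle is a set of strings, identified with its characteristic function $\{0,1\}^*\to\{0,1\}$. A \emph{polynomial-time oracle machine} is a deterministic oracle Turing machine whose running time is bounded, for every oracle, by a fixed polynomial in the length of the input. For oracles $A_0,A_1$, write $M^{A_0,A_1}$ for $M^{A}$, where $A$ is the oracle with $A(i\cdot q)=A_i(q)$ for $i\in\{0,1\}$ and $q\in\{0,1\}^*$ (and the empty string is not in $A$). A language $L$ is \emph{paddable} if there is a polynomial-time machine (without oracle) that, on input $(x,1^m)$ with $|x|\le m$, outputs a string $y$ of length exactly $m$ such that $y\in L$ if and only if $x\in L$. A \emph{deterministic selector} for $L$ is a deterministic polynomial-time oracle machine $S$ such that $S^{L,X}(x)=S^{X,L}(x)=L(x)$ for every oracle $X\subseteq\{0,1\}^*$ and every input $x\in\{0,1\}^*$. For an oracle $R$, $\mathrm{P}^R$ is the class of languages $L$ such that $M^R(x)=L(x)$ for all $x$, for some polynomial-time oracle machine $M$; and $\mathrm{P}^R/\log$ is the class of languages $L$ for which there are a polynomial-time oracle machine $M$ and advice strings $\alpha_n\in\{0,1\}^*$ $(n\in\mathbb{N})$ with $|\alpha_n|=O(\log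 n)$ such that $M^R(x,\alpha_{|x|})=L(x)$ for all $x$. \textbf{Theorem.} Let $L$ be an arbitrary paddable language. The following are equivalent: \begin{enumerate} \item There exists a deterministic selector for $L$. \item For every oracle $R\subseteq\{0,1\}^*$, $L\in\mathrm{P}^R/\log$ implies $L\in\mathrm{P}^R$. \end{enumerate} -/

import Mathlib

/-- Languages and oracles: sets of binary strings. -/
abbrev BinLang : Type := Set (List Bool)

open Classical in
/-- The characteristic function of a language. -/
noncomputable def BinLang.char (L : BinLang) (x : List Bool) : Bool := decide (x ∈ L)

/-- The elementary instructions of a machine with stacks indexed by `K` and control states `Q`.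
A work tape of a Turing machine is a pair of stacks (the parts to the left and to the right of
the head); reading below the bottom of a stack gives the blank symbol `none`. -/
inductive Instr (K Q : Type) : Type
  /-- push the bit `b` onto stack `k` and go to state `next` -/
  | push (k : K) (b : Bool) (next : Q) : Instr K Q
  /-- remove the top of stack `k`, and branch on it (on `none` if the stack is empty) -/
  | pop (k : K) (next : Option Bool → Q) : Instr K Q
  /-- ask the oracle about the string on the query stack, and branch on its answer -/
  | query (yes no : Q) : Instr K Q
  /-- stop -/
  | halt : Instr K Q

/-- A deterministic oracle Turing machine, in the multi-stack form: a finite control that works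
on finitely many stacks of bits, and performs one elementary instruction in each state. -/
structure OracleMachine : Type 1 where
  /-- the index type of the stacks -/
  K : Type
  /-- the control states -/
  Q : Type
  [decEqK : DecidableEq K]
  [finiteK : Finite K]
  [finiteQ : Finite Q]
  /-- the stack that holds the input at the start -/
  inp : K
  /-- the stack that holds the output at the end -/
  out : K
  /-- the stack from which the oracle reads the queries -/
  qry : K
  /-- the initial state -/
  start : Q
  /-- the transition table -/
  prog : Q → Instr K Q

namespace OracleMachine

attribute [instance] decEqK finiteK finiteQ

/-- A configuration: the control state, and the contents of the stacks (top first). -/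
structure Cfg (M : OracleMachine) : Type where
  /-- the current control state -/
  state : M.Q
  /-- the current contents of the stacks -/
  stk : M.K → List Bool

/-- The initial configuration on input `x`: all stacks but the input stack are empty. -/
def init (M : OracleMachine) (x : List Bool) : M.Cfg :=
  ⟨M.start, Function.update (fun _ => []) M.inp x⟩

open Classical in
/-- One step of the computation with oracle `A`; a halted configuration does not change. -/
noncomputable def step (M : OracleMachine) (A : BinLang) (c : M.Cfg) : M.Cfg :=
  match M.prog c.state with
  | .push k b next => ⟨next, Function.update c.stk k (b :: c.stk k)⟩
  | .pop k next => ⟨next (c.stk k).head?, Function.update c.stk k (c.stk k).tail⟩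
  | .query yes no => ⟨if c.stk M.qry ∈ A then yes else no, c.stk⟩
  | .halt => c

/-- With oracle `A`, on input `x`, the machine has halted after at most `t` steps, with
output `y`. -/
def OutputsIn (M : OracleMachine) (A : BinLang) (x : List Bool) (t : ℕ) (y : List Bool) : Prop :=
  M.prog ((M.step A)^[t] (M.init x)).state = Instr.halt ∧
    ((M.step A)^[t] (M.init x)).stk M.out = y

/-- `M^A(x) = y`. -/
def Outputs (M : OracleMachine) (A : BinLang) (x y : List Bool) : Prop :=
  ∃ t : ℕ, M.OutputsIn A x t y

/-- Polynomial-time oracle machine: a fixed polynomial in the length of the input bounds the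
number of steps, on every input and with every oracle. -/
def PolyTime (M : OracleMachine) : Prop :=
  ∃ p : Polynomial ℕ, ∀ (A : BinLang) (x : List Bool),
    ∃ y : List Bool, M.OutputsIn A x (p.eval x.length) y

/-- A plain machine: one that has no query instruction. -/
def OracleFree (M : OracleMachine) : Prop :=
  ∀ q yes no : M.Q, M.prog q ≠ Instr.query yes no

/-- `M^A` computes (the characteristic function of) `L`. -/
def Decides (M : OracleMachine) (A L : BinLang) : Prop :=
  ∀ x : List Bool, M.Outputs A x [L.char x]

end OracleMachine

/-- The encoding of a pair of strings `(x, y)` as one string: the bits of `x`, each preceded by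
a `1`, then a `0`, then `y`. -/
def encodePair (x y : List Bool) : List Bool :=
  x.flatMap (fun b => [true, b]) ++ false :: y

/-- The oracle `A` with `A(i · q) = A_i(q)` for `i ∈ {0, 1}`, which gives access to both of
`A₀` and `A₁`. -/
def joinOracle (A₀ A₁ : BinLang) : BinLang :=
  {w | ∃ q, (w = false :: q ∧ q ∈ A₀) ∨ (w = true :: q ∧ q ∈ A₁)}

/-- A language is paddable if a polynomial-time machine, on input `(x, 1^m)` with `|x| ≤ m`,
outputs a string of length exactly `m` that is in the language iff `x` is. -/
def Paddable (L : BinLang) : Prop :=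
  ∃ M : OracleMachine, M.OracleFree ∧ M.PolyTime ∧
    ∀ (x : List Bool) (m : ℕ), x.length ≤ m →
      ∃ y : List Bool, M.Outputs ∅ (encodePair x (List.replicate m true)) y ∧
        y.length = m ∧ (y ∈ L ↔ x ∈ L)

/-- `S` is a deterministic selector for `L`: a deterministic polynomial-time oracle machine with
`S^{L,X}(x) = S^{X,L}(x) = L(x)` for every oracle `X` and every input `x`. -/
def IsDetSelector (S : OracleMachine) (L : BinLang) : Prop :=
  S.PolyTime ∧ ∀ X : BinLang, S.Decides (joinOracle L X) L ∧ S.Decides (joinOracle X L) L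

/-- The class `P^R`. -/
def PRel (R : BinLang) : Set BinLang :=
  {L | ∃ M : OracleMachine, M.PolyTime ∧ M.Decides R L}

/-- The class `P^R / log`: the languages computed by a polynomial-time machine with oracle `R`
that gets, besides `x`, an advice string of length `O(log |x|)` depending only on `|x|`. -/
def PRelLog (R : BinLang) : Set BinLang :=
  {L | ∃ (M : OracleMachine) (α : ℕ → List Bool) (c : ℕ), M.PolyTime ∧
    (∀ n : ℕ, (α n).length ≤ c * (Nat.log 2 n + 1)) ∧
    ∀ x : List Bool, M.Outputs R (encodePair x (α x.length)) [L.char x]}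

/-! From 1 to 2: let `S` be a selector and let `M` decide `L` from `R` with advice `α`. On input
`x`, all queries of `S` have length at most some `m` polynomial in the length of `x`. Padding every
query to length exactly `m` makes the single advice string `α m` serve them all. So each advice
string `a` defines a candidate oracle for `L`, and the one for `α m` agrees with `L` on every string
that `S` can query. Consider the matrix whose entry at `(a, b)` is the answer of `S` on `x` with the
candidates of `a` and `b` as its two oracles. The row and the column of `α m` consist of the value
`L(x)`. Hence `x ∈ L` iff some row consists of ones: such a row meets the correct column, and
conversely the correct row is one. Only polynomially many advice strings need be tried
(`mem_PRel_of_selector`).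

From 2 to 1: suppose that `L` has no selector. An oracle `R` is built by finite extension,
diagonalizing against the countably many functions computed by polynomial-time machines. When `R` is
fixed below length `n`, hardwiring that part into a machine `M` gives a polynomial-time machine,
which is not a selector. It therefore errs at some `x` with oracle `L ⊕ X` or `X ⊕ L`. Copying that
join into `R` up to the length of the queries makes `M` fail for good (`exists_extension`). At each
length one half of `R` is a copy of `L`, so one bit of advice, naming the half, puts `L` into
`P^R/log`, but not into `P^R` (`exists_selector_of_forall`).

Polynomial time is handled by a calculus: `PolyOp` and `PolyTr` for operations on stacks, `PolyFn`
for functions of strings, closed under composition, bounded recursion (`PolyFn.recList`) and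
simulation of machines (`PolyFn.sim`). `PolyFn.exists_machine` leads back to machines. -/

open Polynomial

/-! ### Stacks -/

/-- Replace the contents of the stack `k` by `l`. -/
noncomputable def setAt {K : Type} (s : K → List Bool) (k : K) (l : List Bool) : K → List Bool :=
  open Classical in Function.update s k l

section setAt

variable {K : Type} (s : K → List Bool) (k j : K) (l l' : List Bool)

@[simp] theorem setAt_same : setAt s k l k = l := by
  classical
  simp [setAt]

open Classical in
theorem setAt_apply : setAt s k l j = if j = k then l else s j := by
  simp [setAt, Function.update_apply]

theorem setAt_of_ne {s : K → List Bool} {k j : K} {l : List Bool} (h : j ≠ k) :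
    setAt s k l j = s j := by
  classical
  rw [setAt_apply, if_neg h]

/-- Machines update stacks with their own decidability instance, `setAt` with the classical one;
this reconciles the two. -/
theorem update_eq_setAt [DecidableEq K] : Function.update s k l = setAt s k l := by
  classical
  funext j
  rw [setAt_apply, Function.update_apply]
  congr

@[simp] theorem setAt_setAt : setAt (setAt s k l) k l' = setAt s k l' := by
  classical
  simp [setAt]

@[simp] theorem setAt_self : setAt s k (s k) = s := by
  classical
  simp [setAt]

end setAt

theorem extend_setAt {K K' : Type} {ι : K → K'} (hι : ι.Injective) (s : K → List Bool)
    (base : K' → List Bool) (k : K) (l : List Bool) :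
    Function.extend ι (setAt s k l) base = setAt (Function.extend ι s base) (ι k) l := by
  classical
  funext j
  by_cases h : ∃ i, ι i = j
  · obtain ⟨i, rfl⟩ := h
    rw [hι.extend_apply, setAt_apply, setAt_apply, hι.extend_apply]
    simp [hι.eq_iff]
  · rw [Function.extend_apply' _ _ _ h, setAt_of_ne, Function.extend_apply' _ _ _ h]
    rintro rfl
    exact h ⟨k, rfl⟩

/-! ### Instructions -/

namespace Instr

variable {K K' P P' : Type}

open Classical in
/-- The effect of an instruction, with oracle `A` and query stack `qk`. -/
noncomputable def exec (A : BinLang) (qk : K) :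
    Instr K P → (K → List Bool) → Option (P × (K → List Bool))
  | .push k b p, s => some (p, setAt s k (b :: s k))
  | .pop k next, s => some (next (s k).head?, setAt s k (s k).tail)
  | .query y n, s => some (if s qk ∈ A then y else n, s)
  | .halt, _ => none

/-- Rename the target states. -/
def mapState (σ : P → P') : Instr K P → Instr K P'
  | .push k b p => .push k b (σ p)
  | .pop k next => .pop k (σ ∘ next)
  | .query y n => .query (σ y) (σ n)
  | .halt => .halt

/-- Rename the stacks. -/
def mapStack (ι : K → K') : Instr K P → Instr K' P
  | .push k b p => .push (ι k) b p
  | .pop k next => .pop (ι k) next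
  | .query y n => .query y n
  | .halt => .halt

theorem exec_mapState (σ : P → P') (A : BinLang) (qk : K) (i : Instr K P) (s : K → List Bool) :
    (i.mapState σ).exec A qk s = (i.exec A qk s).map (Prod.map σ id) := by
  cases i <;> simp [mapState, exec, apply_ite σ]

theorem exec_mapStack {ι : K → K'} (hι : ι.Injective) (A : BinLang) (qk : K) (i : Instr K P)
    (s : K → List Bool) (base : K' → List Bool) :
    (i.mapStack ι).exec A (ι qk) (Function.extend ι s base) =
      (i.exec A qk s).map (Prod.map id fun s' => Function.extend ι s' base) := by
  have h := fun k => hι.extend_apply s base k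
  cases i with
  | query y n =>
    simp only [mapStack, exec, Option.map_some, Prod.map, id]
    rw [h qk]
  | _ => simp [mapStack, exec, extend_setAt hι, h]

theorem exec_length_le {A : BinLang} {qk : K} {i : Instr K P} {s s' : K → List Bool} {p : P}
    (h : i.exec A qk s = some (p, s')) (k : K) : (s' k).length ≤ (s k).length + 1 := by
  classical
  cases i with
  | push j b p =>
    simp only [exec, Option.some.injEq, Prod.mk.injEq] at h
    rw [← h.2, setAt_apply]
    split_ifs with hk
    · simp [hk]
    · simp
  | pop j next =>
    simp only [exec, Option.some.injEq, Prod.mk.injEq] at h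
    rw [← h.2, setAt_apply]
    split_ifs with hk
    · simp only [hk, List.length_tail]; omega
    · simp
  | query y n =>
    simp only [exec, Option.some.injEq, Prod.mk.injEq] at h
    rw [← h.2]; simp
  | halt => simp [exec] at h

end Instr

/-! ### Program fragments -/

/-- A piece of a transition table on the stacks `K`, which may be left through the exits `E`. -/
structure Frag (K E : Type) : Type 1 where
  /-- the control states -/
  Q : Type
  [finiteQ : Finite Q]
  /-- the initial state -/
  start : Q
  /-- the transition table -/
  prog : Q → Instr K (Q ⊕ E)

namespace Frag

attribute [instance] finiteQ

variable {K K' E E' : Type} {A : BinLang} {qk : K}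

/-- `F.Run A qk q s t s' e`: started in state `q` with stacks `s`, the fragment exits after
exactly `t` steps through `e`, with stacks `s'`. -/
inductive Run (A : BinLang) (qk : K) (F : Frag K E) :
    F.Q → (K → List Bool) → ℕ → (K → List Bool) → E → Prop
  | exit {q s s' e} : (F.prog q).exec A qk s = some (.inr e, s') → Run A qk F q s 1 s' e
  | next {q s q₁ s₁ t s' e} : (F.prog q).exec A qk s = some (.inl q₁, s₁) →
      Run A qk F q₁ s₁ t s' e → Run A qk F q s (t + 1) s' e

theorem Run.length_le {F : Frag K E} {q s t s' e} (h : F.Run A qk q s t s' e) (k : K) :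
    (s' k).length ≤ (s k).length + t := by
  induction h with
  | exit h => exact Instr.exec_length_le h k
  | next h _ ih => have := Instr.exec_length_le h k; omega

/-- Rename the stacks of a fragment. -/
def mapStack (ι : K → K') (F : Frag K E) : Frag K' E where
  Q := F.Q
  start := F.start
  prog q := (F.prog q).mapStack ι

theorem Run.mapStack {ι : K → K'} (hι : ι.Injective) {F : Frag K E} {q s t s' e}
    (h : F.Run A qk q s t s' e) (base : K' → List Bool) :
    (F.mapStack ι).Run A (ι qk) q (Function.extend ι s base) t (Function.extend ι s' base) e := by
  induction h with
  | exit h => exact .exit (by simp [Frag.mapStack, Instr.exec_mapStack hι, h])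
  | next h _ ih => exact .next (by simp [Frag.mapStack, Instr.exec_mapStack hι, h]) ih

/-- Variant of `Run.mapStack` for stack families that are only known pointwise, which spares
`Function.extend` in the applications. -/
theorem Run.lift {ι : K → K'} (hι : ι.Injective) {F : Frag K E} {q s t s' e}
    (h : F.Run A qk q s t s' e) {qk' : K'} (hq : ι qk = qk') {S S' : K' → List Bool}
    (hS : ∀ k, S (ι k) = s k) (hS' : ∀ k, S' (ι k) = s' k)
    (hSS' : ∀ j, (∀ k, ι k ≠ j) → S' j = S j) :
    (F.mapStack ι).Run A qk' q S t S' e := by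
  subst hq
  have h1 : Function.extend ι s S = S := by
    funext j
    by_cases hj : ∃ k, ι k = j
    · obtain ⟨k, rfl⟩ := hj
      rw [hι.extend_apply, hS]
    · rw [Function.extend_apply' _ _ _ hj]
  have h2 : Function.extend ι s' S = S' := by
    funext j
    by_cases hj : ∃ k, ι k = j
    · obtain ⟨k, rfl⟩ := hj
      rw [hι.extend_apply, hS']
    · rw [Function.extend_apply' _ _ _ hj, hSS' j fun k hk => hj ⟨k, hk⟩]
  have := h.mapStack hι S
  rwa [h1, h2] at this

/-- Run a fragment, then the fragment that its exit selects. -/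
def bind [Finite E] (F : Frag K E) (G : E → Frag K E') : Frag K E' where
  Q := F.Q ⊕ Σ e, (G e).Q
  start := .inl F.start
  prog
    | .inl q => (F.prog q).mapState fun
      | .inl q' => .inl (.inl q')
      | .inr e => .inl (.inr ⟨e, (G e).start⟩)
    | .inr ⟨e, q⟩ => ((G e).prog q).mapState fun
      | .inl q' => .inl (.inr ⟨e, q'⟩)
      | .inr x => .inr x

theorem Run.bind_right [Finite E] {F : Frag K E} {G : E → Frag K E'} {e q s t s' x}
    (h : (G e).Run A qk q s t s' x) : (F.bind G).Run A qk (.inr ⟨e, q⟩) s t s' x := by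
  induction h with
  | exit h => exact .exit (by simp [Frag.bind, Instr.exec_mapState, h])
  | next h _ ih => exact .next (by simp [Frag.bind, Instr.exec_mapState, h]) ih

theorem Run.bind [Finite E] {F : Frag K E} {G : E → Frag K E'} {q s t s₁ e t' s' x}
    (h : F.Run A qk q s t s₁ e) (h' : (G e).Run A qk (G e).start s₁ t' s' x) :
    (F.bind G).Run A qk (.inl q) s (t + t') s' x := by
  induction h with
  | exit h =>
    rw [add_comm]
    exact .next (by simp [Frag.bind, Instr.exec_mapState, h]) h'.bind_right
  | next h _ ih =>
    rw [add_right_comm]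
    exact .next (by simp [Frag.bind, Instr.exec_mapState, h]) (ih h')

/-- Run fragments until one of them leaves the loop. -/
def loop [Finite E] (F : E → Frag K (E ⊕ E')) (e : E) : Frag K E' where
  Q := Σ e, (F e).Q
  start := ⟨e, (F e).start⟩
  prog := fun ⟨e, q⟩ => ((F e).prog q).mapState fun
    | .inl q' => .inl ⟨e, q'⟩
    | .inr (.inl e') => .inl ⟨e', (F e').start⟩
    | .inr (.inr x) => .inr x

theorem Run.loop_exit [Finite E] {F : E → Frag K (E ⊕ E')} {e₀ e q s t s' y}
    (h : (F e).Run A qk q s t s' y) : ∀ {x}, y = .inr x →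
      (Frag.loop F e₀).Run A qk ⟨e, q⟩ s t s' x := by
  induction h with
  | exit h =>
    rintro x rfl
    exact .exit (by simp [Frag.loop, Instr.exec_mapState, h])
  | next h _ ih =>
    rintro x rfl
    exact .next (by simp [Frag.loop, Instr.exec_mapState, h]) (ih rfl)

theorem Run.loop_next [Finite E] {F : E → Frag K (E ⊕ E')} {e₀ e q s t s₁ y}
    (h : (F e).Run A qk q s t s₁ y) : ∀ {e' t' s' x}, y = .inl e' →
      (Frag.loop F e₀).Run A qk ⟨e', (F e').start⟩ s₁ t' s' x →
      (Frag.loop F e₀).Run A qk ⟨e, q⟩ s (t + t') s' x := by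
  induction h with
  | exit h =>
    rintro e' t' s' x rfl h'
    rw [add_comm]
    exact .next (by simp [Frag.loop, Instr.exec_mapState, h]) h'
  | next h _ ih =>
    rintro e' t' s' x rfl h'
    rw [add_right_comm]
    exact .next (by simp [Frag.loop, Instr.exec_mapState, h]) (ih rfl h')

end Frag

/-! ### Polynomial-time operations on stacks -/

theorem eval_monotone (p : ℕ[X]) : Monotone fun n => p.eval n := by
  intro a b hab
  induction p using Polynomial.induction_on' with
  | add p q hp hq => simpa using add_le_add hp hq
  | monomial n c =>
    simp only [eval_monomial]
    gcongr

theorem exists_poly_bound {E : Type} [Finite E] (p : E → ℕ[X]) :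
    ∃ q : ℕ[X], ∀ e n, (p e).eval n ≤ q.eval n := by
  have := Fintype.ofFinite E
  refine ⟨∑ e, p e, fun e n => ?_⟩
  rw [eval_finsetSum]
  exact Finset.single_le_sum (f := fun e => (p e).eval n) (fun _ _ => Nat.zero_le _)
    (Finset.mem_univ e)

/-- All stacks have length at most `N`. -/
def Bdd {V : Type} (N : ℕ) (s : V → List Bool) : Prop := ∀ v, (s v).length ≤ N

theorem Bdd.mono {V : Type} {N N' : ℕ} {s : V → List Bool} (h : Bdd N s) (hN : N ≤ N') :
    Bdd N' s := fun v => (h v).trans hN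

/-- The visible stacks `s`, together with empty auxiliary stacks; the stack `Sum.inr none` is
used for queries. -/
def clean {V W : Type} (s : V → List Bool) : V ⊕ Option W → List Bool :=
  Sum.elim s fun _ => []

theorem setAt_clean {V W : Type} (s : V → List Bool) (v : V) (l : List Bool) :
    setAt (clean (W := W) s) (.inl v) l = clean (setAt s v l) := by
  classical
  funext k
  rcases k with k | k <;> simp [clean, setAt_apply]

/-- An operation on stacks, returning a value in `E`, which program fragments with auxiliary
stacks perform in polynomial time. -/
def PolyOp {V E : Type} (f : BinLang → (V → List Bool) → (V → List Bool) × E) : Prop :=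
  ∃ (W : Type) (_ : Finite W) (F : Frag (V ⊕ Option W) E) (p : ℕ[X]), ∀ A N s, Bdd N s →
    ∃ t ≤ p.eval N, F.Run A (.inr none) F.start (clean s) t (clean (f A s).1) (f A s).2

/-- A polynomial-time operation on stacks without a return value. -/
def PolyTr {V : Type} (f : BinLang → (V → List Bool) → V → List Bool) : Prop :=
  PolyOp fun A s => (f A s, ())

/-- `Iter body B e s n s' x`: the loop with the given body, started with value `e` and stacks `s`,
is left after `n` rounds with value `x` and stacks `s'`, and the stacks are bounded by `B` at the
start of each round. -/
inductive Iter {V E E' : Type} (body : E → (V → List Bool) → (V → List Bool) × (E ⊕ E')) (B : ℕ) :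
    E → (V → List Bool) → ℕ → (V → List Bool) → E' → Prop
  | exit {e s s' x} : Bdd B s → body e s = (s', .inr x) → Iter body B e s 1 s' x
  | next {e s e₁ s₁ n s' x} : Bdd B s → body e s = (s₁, .inl e₁) → Iter body B e₁ s₁ n s' x →
      Iter body B e s (n + 1) s' x

/-- A run that begins and ends with empty auxiliary stacks can be embedded among further stacks,
visible or auxiliary, which it leaves alone. -/
theorem Frag.Run.clean {V V' W W' E : Type} {A : BinLang} {F : Frag (V ⊕ Option W) E} {q s t s' e}
    (h : F.Run A (.inr none) q (clean s) t (clean s') e) {j : W → W'} (hj : j.Injective)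
    {ι : V → V'} (hι : ι.Injective) (base : V' → List Bool) :
    (F.mapStack (Sum.map ι (Option.map j))).Run A (.inr none) q
      (_root_.clean (Function.extend ι s base)) t (_root_.clean (Function.extend ι s' base)) e := by
  refine h.lift (Function.Injective.sumMap hι (Option.map_injective hj)) rfl ?_ ?_ ?_
  · rintro (k | k) <;> simp [_root_.clean, hι.extend_apply]
  · rintro (k | k) <;> simp [_root_.clean, hι.extend_apply]
  · rintro (k | k) hk
    · have : ¬ ∃ i, ι i = k := fun ⟨i, hi⟩ => hk (.inl i) (by simp [hi])
      simp [_root_.clean, Function.extend_apply' _ _ _ this]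
    · simp [_root_.clean]

theorem Frag.Run.clean_aux {V W W' E : Type} {A : BinLang} {F : Frag (V ⊕ Option W) E}
    {q s t s' e} (h : F.Run A (.inr none) q (_root_.clean s) t (_root_.clean s') e)
    {j : W → W'} (hj : j.Injective) :
    (F.mapStack (Sum.map id (Option.map j))).Run A (.inr none) q (_root_.clean s) t
      (_root_.clean s') e := by
  have hid : ∀ s : V → List Bool, Function.extend id s s = s := fun s => by
    funext k
    exact Function.injective_id.extend_apply s s k
  have hid' : Function.extend id s' s = s' := by
    funext k
    exact Function.injective_id.extend_apply s' s k
  have := h.clean hj Function.injective_id s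
  rwa [hid, hid'] at this

/-! ### Control flow for polynomial-time operations -/

namespace PolyOp

variable {V V' U E E' : Type}

theorem congr {f g : BinLang → (V → List Bool) → (V → List Bool) × E} (hf : PolyOp f)
    (h : ∀ A s, f A s = g A s) : PolyOp g := by
  have : f = g := by
    funext A s
    exact h A s
  exact this ▸ hf

/-- A step lengthens a stack by at most one bit, so the time bound also bounds the growth. -/
theorem exists_bound {f : BinLang → (V → List Bool) → (V → List Bool) × E} (hf : PolyOp f) :
    ∃ p : ℕ[X], ∀ A N s, Bdd N s → Bdd (p.eval N) (f A s).1 := by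
  obtain ⟨W, _, F, p, h⟩ := hf
  refine ⟨X + p, fun A N s hs v => ?_⟩
  obtain ⟨t, ht, h⟩ := h A N s hs
  have h1 := h.length_le (.inl v)
  have h2 := hs v
  simp only [clean, Sum.elim_inl, eval_add, eval_X] at *
  omega

theorem ret (e : E) : PolyOp fun _ (s : V → List Bool) => (s, e) := by
  -- A fragment makes at least one step; a query with equal branches has no effect.
  refine ⟨Empty, inferInstance, ⟨Unit, (), fun _ => .query (.inr e) (.inr e)⟩, 1,
    fun A N s _ => ⟨1, by simp, .exit ?_⟩⟩
  simp [Instr.exec]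

theorem push (v : V) (b : Bool) : PolyTr fun _ s => setAt s v (b :: s v) := by
  refine ⟨Empty, inferInstance, ⟨Unit, (), fun _ => .push (.inl v) b (.inr ())⟩, 1,
    fun A N s _ => ⟨1, by simp, .exit ?_⟩⟩
  simp only [Instr.exec, setAt_clean]
  rfl

theorem pop (v : V) : PolyOp fun _ s => (setAt s v (s v).tail, (s v).head?) := by
  refine ⟨Empty, inferInstance, ⟨Unit, (), fun _ => .pop (.inl v) .inr⟩, 1,
    fun A N s _ => ⟨1, by simp, .exit ?_⟩⟩
  simp only [Instr.exec, setAt_clean]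
  rfl

/-- Every part has private auxiliary stacks. The second part starts on stacks of length up to `r`,
whence its time `q.comp r`. -/
theorem bind [Finite E] {f : BinLang → (V → List Bool) → (V → List Bool) × E}
    {g : E → BinLang → (V → List Bool) → (V → List Bool) × E'} (hf : PolyOp f)
    (hg : ∀ e, PolyOp (g e)) : PolyOp fun A s => g (f A s).2 A (f A s).1 := by
  obtain ⟨r, hr⟩ := hf.exists_bound
  obtain ⟨W, _, F, p, hF⟩ := hf
  choose W' _ G p' hG using hg
  obtain ⟨q, hq⟩ := exists_poly_bound p'
  refine ⟨W ⊕ Σ e, W' e, inferInstance, (F.mapStack (Sum.map id (Option.map .inl))).bind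
    fun e => (G e).mapStack (Sum.map id (Option.map fun w => .inr ⟨e, w⟩)), p + q.comp r,
    fun A N s hs => ?_⟩
  obtain ⟨t, ht, h⟩ := hF A N s hs
  obtain ⟨t', ht', h'⟩ := hG (f A s).2 A _ _ (hr A N s hs)
  refine ⟨t + t', ?_, (h.clean_aux Sum.inl_injective).bind (h'.clean_aux ?_)⟩
  · rw [eval_add, eval_comp]
    exact add_le_add ht (ht'.trans (hq _ _))
  · exact Sum.inr_injective.comp sigma_mk_injective

/-- A polynomial number of rounds is not enough, since the stacks might double in each round; so
`Iter` also bounds the stacks at the start of every round. -/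
theorem loop [Finite E] {init : BinLang → (V → List Bool) → (V → List Bool) × E}
    {body : E → BinLang → (V → List Bool) → (V → List Bool) × (E ⊕ E')}
    {h : BinLang → (V → List Bool) → (V → List Bool) × E'} (hi : PolyOp init)
    (hb : ∀ e, PolyOp (body e)) (p : ℕ[X])
    (H : ∀ A N s, Bdd N s → ∃ n ≤ p.eval N, Iter (fun e => body e A) (p.eval N) (init A s).2
      (init A s).1 n (h A s).1 (h A s).2) : PolyOp h := by
  obtain ⟨W, _, F, r, hF⟩ := hi
  choose W' _ G p' hG using hb
  obtain ⟨q, hq⟩ := exists_poly_bound p'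
  set G' : E → Frag (V ⊕ Option (W ⊕ Σ e, W' e)) (E ⊕ E') :=
    fun e => (G e).mapStack (Sum.map id (Option.map fun w => .inr ⟨e, w⟩)) with hG'
  have key : ∀ A B e s n s' x, Iter (fun e => body e A) B e s n s' x → ∀ e₀, ∃ t ≤ n * q.eval B,
      (Frag.loop G' e₀).Run A (.inr none) ⟨e, (G' e).start⟩ (clean s) t (clean s') x := by
    intro A B e s n s' x h e₀
    have step : ∀ e s s₁ y, Bdd B s → body e A s = (s₁, y) → ∃ t ≤ q.eval B,
        (G' e).Run A (.inr none) (G' e).start (clean s) t (clean s₁) y := by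
      intro e s s₁ y hs hy
      obtain ⟨t, ht, h⟩ := hG e A B s hs
      rw [hy] at h
      exact ⟨t, ht.trans (hq _ _), h.clean_aux (Sum.inr_injective.comp sigma_mk_injective)⟩
    induction h with
    | exit hs hy =>
      obtain ⟨t, ht, h⟩ := step _ _ _ _ hs hy
      exact ⟨t, by simpa using ht, h.loop_exit rfl⟩
    | next hs hy _ ih =>
      obtain ⟨t, ht, h⟩ := step _ _ _ _ hs hy
      obtain ⟨t', ht', h'⟩ := ih
      exact ⟨t + t', by rw [add_mul, one_mul]; omega, h.loop_next rfl h'⟩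
  refine ⟨W ⊕ Σ e, W' e, inferInstance, (F.mapStack (Sum.map id (Option.map .inl))).bind
    fun e => Frag.loop G' e, r + p * q.comp p, fun A N s hs => ?_⟩
  obtain ⟨t, ht, h₁⟩ := hF A N s hs
  obtain ⟨n, hn, hI⟩ := H A N s hs
  obtain ⟨t', ht', h₂⟩ := key _ _ _ _ _ _ _ hI (init A s).2
  refine ⟨t + t', ?_, (h₁.clean_aux Sum.inl_injective).bind h₂⟩
  rw [eval_add, eval_mul, eval_comp]
  exact add_le_add ht (ht'.trans (Nat.mul_le_mul_right _ hn))

theorem reindex {f : BinLang → (V → List Bool) → (V → List Bool) × E} (hf : PolyOp f)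
    {ι : V → V'} (hι : ι.Injective) :
    PolyOp fun A s => (Function.extend ι (f A (s ∘ ι)).1 s, (f A (s ∘ ι)).2) := by
  obtain ⟨W, _, F, p, hF⟩ := hf
  refine ⟨W, inferInstance, F.mapStack (Sum.map ι (Option.map id)), p, fun A N s hs => ?_⟩
  obtain ⟨t, ht, h⟩ := hF A N (s ∘ ι) fun v => hs _
  have h1 : Function.extend ι (s ∘ ι) s = s := by
    funext j
    by_cases hj : ∃ k, ι k = j
    · obtain ⟨k, rfl⟩ := hj
      simp [hι.extend_apply]
    · rw [Function.extend_apply' _ _ _ hj]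
  have := h.clean Function.injective_id hι s
  rw [h1] at this
  exact ⟨t, ht, this⟩

end PolyOp

namespace PolyTr

variable {V V' U E : Type}

theorem congr {f g : BinLang → (V → List Bool) → V → List Bool} (hf : PolyTr f)
    (h : ∀ A s v, f A s v = g A s v) : PolyTr g :=
  PolyOp.congr hf fun A s => by
    rw [Prod.mk.injEq]
    exact ⟨funext (h A s), rfl⟩

theorem id : PolyTr fun _ (s : V → List Bool) => s := PolyOp.ret ()

theorem comp {f g : BinLang → (V → List Bool) → V → List Bool} (hg : PolyTr g) (hf : PolyTr f) :
    PolyTr fun A s => g A (f A s) :=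
  PolyOp.bind (g := fun _ A s => (g A s, ())) hf fun _ => hg

theorem ret {f : BinLang → (V → List Bool) → V → List Bool} (hf : PolyTr f) (e : E) :
    PolyOp fun A s => (f A s, e) :=
  PolyOp.bind (g := fun _ _ s => (s, e)) hf fun _ => PolyOp.ret e

theorem bind [Finite E] {f : BinLang → (V → List Bool) → (V → List Bool) × E}
    {g : E → BinLang → (V → List Bool) → V → List Bool} (hf : PolyOp f) (hg : ∀ e, PolyTr (g e)) :
    PolyTr fun A s => g (f A s).2 A (f A s).1 :=
  PolyOp.bind (g := fun e A s => (g e A s, ())) hf hg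

/-- A loop that consumes the stack `v` bit by bit. The invariant is `cur A s pre l`: the stacks when
`pre` has been read and `l` remains. -/
theorem each {v : V} {init : BinLang → (V → List Bool) → V → List Bool}
    {g : Bool → BinLang → (V → List Bool) → V → List Bool}
    {cur : BinLang → (V → List Bool) → List Bool → List Bool → V → List Bool}
    (hi : PolyTr init) (hg : ∀ b, PolyTr (g b)) (p : ℕ[X])
    (h0 : ∀ A s, cur A s [] (init A s v) = init A s)
    (h1 : ∀ A s pre b l, init A s v = pre ++ b :: l →
      g b A (setAt (cur A s pre (b :: l)) v l) = cur A s (pre ++ [b]) l)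
    (hv : ∀ A s pre l, init A s v = pre ++ l → cur A s pre l v = l)
    (hp : ∀ A N s pre l, Bdd N s → init A s v = pre ++ l → Bdd (p.eval N) (cur A s pre l)) :
    PolyTr fun A s => cur A s (init A s v) [] := by
  obtain ⟨r, hr⟩ := hi.exists_bound
  have hbody : PolyOp (V := V) (E := Unit ⊕ Unit) fun A s => match (s v).head? with
      | none => (setAt s v (s v).tail, .inr ())
      | some b => (g b A (setAt s v (s v).tail), .inl ()) := by
    refine (PolyOp.bind (E' := Unit ⊕ Unit) (PolyOp.pop v) (g := fun o A s => match o with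
      | none => (s, .inr ())
      | some b => (g b A s, .inl ())) ?_).congr fun A s => ?_
    · rintro (_ | b)
      · exact PolyOp.ret _
      · exact (hg b).ret _
    · cases (s v).head? <;> simp
  refine PolyOp.loop (E := Unit) (init := fun A s => (init A s, ())) hi (fun _ => hbody)
    -- There are at most `r` rounds that read a bit and one that finds the stack empty; `p` bounds
    -- the stacks.
    (p + r + 1) fun A N s hs => ?_
  have key : ∀ l pre, init A s v = pre ++ l → Iter (fun _ s => match (s v).head? with
      | none => (setAt s v (s v).tail, Sum.inr ())
      | some b => (g b A (setAt s v (s v).tail), Sum.inl ())) ((p + r + 1).eval N) ()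
      (cur A s pre l) (l.length + 1) (cur A s (init A s v) []) () := by
    intro l
    induction l with
    | nil =>
      intro pre h
      have hpre : pre = init A s v := by simp [h]
      refine .exit ((hp A N s pre _ hs h).mono (by simp; omega)) ?_
      have := hv A s pre [] h
      have h' := setAt_self (cur A s pre []) v
      rw [this] at h'
      simp only [this, List.head?_nil, List.tail_nil]
      rw [← hpre, h']
    | cons b l ih =>
      intro pre h
      refine .next ((hp A N s pre _ hs h).mono (by simp; omega)) ?_
        (ih (pre ++ [b]) (by simp [h]))
      have := hv A s pre _ h
      simp only [this, List.head?_cons, List.tail_cons]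
      rw [h1 A s pre b l h]
  have h2 := key (init A s v) [] (by simp)
  rw [h0] at h2
  refine ⟨_, ?_, h2⟩
  have h3 : (init A s v).length ≤ _ := hr A N s hs v
  simp only [eval_add, eval_one]
  omega

open Classical in
theorem pushAll (ws : List V) (hws : ws.Nodup) (b : Bool) :
    PolyTr fun _ s k => if k ∈ ws then b :: s k else s k := by
  induction ws with
  | nil => exact id.congr fun A s v => by simp
  | cons w ws ih =>
    rw [List.nodup_cons] at hws
    refine (comp (ih hws.2) (PolyOp.push w b)).congr fun A s v => ?_
    rw [setAt_apply]
    by_cases hv : v = w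
    · subst hv
      simp [hws.1]
    · simp [hv]

open Classical in
/-- Empty the stack `v` onto the stacks `ws`. -/
theorem drain (v : V) (ws : List V) (hws : ws.Nodup) (hv : v ∉ ws) :
    PolyTr fun _ s k => if k = v then [] else if k ∈ ws then (s v).reverse ++ s k else s k := by
  refine each (v := v) (init := fun _ s => s) (cur := fun _ s pre l k =>
    if k = v then l else if k ∈ ws then pre.reverse ++ s k else s k) id
    (fun b => pushAll ws hws b) (2 * X) ?_ ?_ ?_ ?_
  · intro A s
    funext k
    by_cases hk : k = v <;> simp [hk]
  · intro A s pre b l _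
    funext k
    rw [setAt_apply]
    by_cases hk : k = v
    · simp [hk, hv]
    · by_cases hk' : k ∈ ws <;> simp [hk, hk']
  · simp
  · intro A N s pre l hs h k
    have h1 := hs v
    have h2 := hs k
    simp only [eval_mul, eval_ofNat, eval_X]
    rw [h, List.length_append] at h1
    split_ifs <;> simp <;> omega

theorem clear (v : V) : PolyTr fun _ s => setAt s v [] :=
  (drain v [] List.nodup_nil List.not_mem_nil).congr fun A s k => by
    simp [setAt_apply]

open Classical in
theorem clearAll (us : List V) : PolyTr fun _ s k => if k ∈ us then [] else s k := by
  induction us with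
  | nil => exact id.congr fun A s v => by simp
  | cons u us ih =>
    refine (comp (clear u) ih).congr fun A s v => ?_
    rw [setAt_apply]
    by_cases hv : v = u <;> simp [hv]

/-- Regard some stacks as auxiliary: they are empty at the start, and are cleared at the end. -/
theorem hide [Finite U] {f : BinLang → (V ⊕ U → List Bool) → V ⊕ U → List Bool} (hf : PolyTr f) :
    PolyTr fun A s v => f A (Sum.elim s fun _ => []) (.inl v) := by
  classical
  have := Fintype.ofFinite U
  have hc := comp (clearAll ((Finset.univ : Finset U).toList.map (Sum.inr : U → V ⊕ U))) hf
  obtain ⟨W, _, F, p, hF⟩ := hc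
  let ι : (V ⊕ U) ⊕ Option W → V ⊕ Option (U ⊕ W) := fun k => match k with
    | .inl (.inl v) => .inl v
    | .inl (.inr u) => .inr (some (.inl u))
    | .inr none => .inr none
    | .inr (some w) => .inr (some (.inr w))
  have hι : ι.Injective := by
    rintro ((_ | _) | (_ | _)) ((_ | _) | (_ | _)) h <;> simp_all [ι]
  refine ⟨U ⊕ W, inferInstance, F.mapStack ι, p, fun A N s hs => ?_⟩
  obtain ⟨t, ht, h⟩ := hF A N (Sum.elim s fun _ => []) (by
    rintro (v | v)
    · exact hs v
    · simp)
  refine ⟨t, ht, h.lift hι rfl ?_ ?_ ?_⟩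
  · rintro ((_ | _) | (_ | _)) <;> simp [ι, clean]
  · rintro ((_ | _) | (_ | _)) <;> simp [ι, clean]
  · rintro (v | (_ | _ | _)) hk <;> simp [clean]
    exact (hk (.inl (.inl v)) rfl).elim

end PolyTr

/-- Ask the oracle about the reversal of the contents of a stack, which is emptied. -/
theorem PolyOp.ask {V : Type} (v : V) :
    PolyOp fun A s => (setAt s v [], BinLang.char A (s v).reverse) := by
  classical
  -- Bits are moved one at a time to the query stack, which reverses them. After the query the
  -- control state keeps the answer while the query stack is emptied.
  let F : Frag (V ⊕ Option Empty) Bool :=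
    { Q := Unit ⊕ Bool ⊕ Unit ⊕ Bool
      start := .inl ()
      prog := fun q => match q with
        | .inl _ => .pop (.inl v) fun o => match o with
          | some b => .inl (.inr (.inl b))
          | none => .inl (.inr (.inr (.inl ())))
        | .inr (.inl b) => .push (.inr none) b (.inl (.inl ()))
        | .inr (.inr (.inl _)) => .query (.inl (.inr (.inr (.inr true))))
            (.inl (.inr (.inr (.inr false))))
        | .inr (.inr (.inr c)) => .pop (.inr none) fun o => match o with
          | some _ => .inl (.inr (.inr (.inr c)))
          | none => .inr c }
  let st : (V → List Bool) → List Bool → List Bool → V ⊕ Option Empty → List Bool :=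
    fun s l q => setAt (setAt (clean s) (.inl v) l) (.inr none) q
  have h1 : ∀ A s c q, F.Run A (.inr none) (.inr (.inr (.inr c))) (st s [] q) (q.length + 1)
      (st s [] []) c := by
    intro A s c q
    induction q with
    | nil => exact .exit (by simp [F, st, Instr.exec])
    | cons b q ih => exact .next (by simp [F, st, Instr.exec]) ih
  -- Each bit of `l` costs two steps to move and one to erase, each bit of `q` one to erase; the
  -- query and two pops of empty stacks make 3.
  have h2 : ∀ A s l q, F.Run A (.inr none) (.inl ()) (st s l q) (3 * l.length + q.length + 3)
      (st s [] []) (BinLang.char A (l.reverse ++ q)) := by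
    intro A s l
    induction l with
    | nil =>
      intro q
      refine .next (F := F) (q₁ := Sum.inr (.inr (.inl ()))) (s₁ := st s [] q)
        ?_ ?_
      · simp only [F, st, Instr.exec, setAt_of_ne (show (Sum.inl v : V ⊕ Option Empty) ≠
          .inr none by simp), setAt_same, List.head?_nil, List.tail_nil, Option.some.injEq,
          Prod.mk.injEq, true_and]
        funext k
        simp only [setAt_apply]
        rcases k with k | k
        · simp; grind
        · simp
      have := h1 A s (BinLang.char A q) q
      simp only [List.length_nil, mul_zero, zero_add, List.reverse_nil, List.nil_append]
      refine .next (F := F) (q₁ := Sum.inr (Sum.inr (Sum.inr (BinLang.char A q)))) ?_ this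
      by_cases hq : q ∈ A <;> simp [F, st, Instr.exec, BinLang.char, hq]
    | cons b l ih =>
      intro q
      have := ih (b :: q)
      rw [show 3 * (b :: l).length + q.length + 3 = 3 * l.length + q.length + 5 + 1 by
        simp only [List.length_cons]; omega]
      refine .next (F := F) (q₁ := Sum.inr (.inl b)) (s₁ := st s l q)
        (t := 3 * l.length + q.length + 5) ?_ ?_
      · simp only [F, st, Instr.exec, setAt_same, setAt_of_ne (show (Sum.inl v : V ⊕ Option Empty) ≠
          .inr none by simp), List.head?_cons, List.tail_cons, Option.some.injEq, Prod.mk.injEq,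
          true_and]
        funext k
        simp only [setAt_apply]
        rcases k with k | k
        · simp; grind
        · simp
      · refine .next (F := F) (q₁ := Sum.inl ()) (s₁ := st s l (b :: q))
          (t := 3 * l.length + q.length + 4) ?_ ?_
        · simp [F, st, Instr.exec]
        · convert this using 1
          · simp; omega
          · simp
  refine ⟨Empty, inferInstance, F, 3 * X + 3, fun A N s hs =>
    ⟨3 * (s v).length + 3, ?_, ?_⟩⟩
  · have := hs v
    simp only [eval_add, eval_mul, eval_ofNat, eval_X]
    omega
  · have := h2 A s (s v) []
    have e1 : st s (s v) [] = clean s := by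
      funext k
      simp only [st, setAt_apply]
      rcases k with k | k <;> simp [clean]
      rintro rfl
      rfl
    have e2 : st s [] [] = clean (setAt s v []) := by
      funext k
      simp only [st, setAt_apply, ← setAt_clean]
      rcases k with k | k <;> simp [clean]
    rw [e1, e2] at this
    simpa using this

/-! ### The function computed by a machine -/

namespace OracleMachine

variable {M : OracleMachine} {A : BinLang} {x y y' : List Bool} {t t' : ℕ}

theorem step_of_halt {c : M.Cfg} (h : M.prog c.state = .halt) : M.step A c = c := by
  simp [step, h]

theorem iterate_step_of_halt {c : M.Cfg} (h : M.prog c.state = .halt) (t : ℕ) :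
    (M.step A)^[t] c = c :=
  Function.iterate_fixed (step_of_halt h) t

theorem OutputsIn.mono (h : M.OutputsIn A x t y) (ht : t ≤ t') : M.OutputsIn A x t' y := by
  obtain ⟨d, rfl⟩ := Nat.exists_eq_add_of_le ht
  rw [OutputsIn, add_comm, Function.iterate_add_apply, iterate_step_of_halt h.1]
  exact h

theorem Outputs.unique (h : M.Outputs A x y) (h' : M.Outputs A x y') : y = y' := by
  obtain ⟨t, h⟩ := h
  obtain ⟨t', h'⟩ := h'
  exact (h.mono (le_max_left t t')).2.symm.trans (h'.mono (le_max_right t t')).2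

open Classical in
/-- The output of a machine on an input, and the empty string if it does not halt. -/
noncomputable def fn (M : OracleMachine) (A : BinLang) (x : List Bool) : List Bool :=
  if h : ∃ y, M.Outputs A x y then h.choose else []

theorem Outputs.fn_eq (h : M.Outputs A x y) : M.fn A x = y := by
  have h' : ∃ y, M.Outputs A x y := ⟨y, h⟩
  rw [fn, dif_pos h']
  exact h'.choose_spec.unique h

theorem PolyTime.outputs_iff (hM : M.PolyTime) : M.Outputs A x y ↔ M.fn A x = y := by
  refine ⟨Outputs.fn_eq, ?_⟩
  rintro rfl
  obtain ⟨p, hp⟩ := hM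
  obtain ⟨y, hy⟩ := hp A x
  have : M.Outputs A x y := ⟨_, hy⟩
  rwa [this.fn_eq]

theorem step_length_le (c : M.Cfg) (k : M.K) :
    ((M.step A c).stk k).length ≤ (c.stk k).length + 1 := by
  rw [step]
  cases M.prog c.state with
  | push j b next => by_cases h : k = j <;> simp [h]
  | pop j next => by_cases h : k = j <;> simp [h]; omega
  | query => simp
  | halt => simp

theorem iterate_step_length_le (c : M.Cfg) (k : M.K) (t : ℕ) :
    (((M.step A)^[t] c).stk k).length ≤ (c.stk k).length + t := by
  induction t with
  | zero => simp
  | succ t ih =>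
    rw [Function.iterate_succ_apply']
    exact (step_length_le _ k).trans (by omega)

/-- Oracles that agree on all strings as long as the queries that the time allows give the same
computation. -/
theorem iterate_step_congr {B : BinLang} {N : ℕ}
    (hAB : ∀ q : List Bool, q.length ≤ N → (q ∈ A ↔ q ∈ B)) (c : M.Cfg) :
    ∀ t, (c.stk M.qry).length + t ≤ N → (M.step A)^[t] c = (M.step B)^[t] c := by
  intro t
  induction t with
  | zero => simp
  | succ t ih =>
    intro ht
    rw [Function.iterate_succ_apply', Function.iterate_succ_apply', ← ih (by omega)]
    have hl := iterate_step_length_le (A := A) c M.qry t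
    have := hAB (((M.step A)^[t] c).stk M.qry) (by omega)
    rw [step, step]
    cases M.prog ((M.step A)^[t] c).state with
    | query y n =>
      by_cases hA : ((M.step A)^[t] c).stk M.qry ∈ A
      · simp [hA, this.1 hA]
      · simp [hA, mt this.2 hA]
    | _ => rfl

/-- The query stack has length at most that of the input plus the time, so longer strings are never
queried. -/
theorem fn_congr {B : BinLang} {p : ℕ[X]}
    (hp : ∀ (A : BinLang) (x : List Bool), ∃ y, M.OutputsIn A x (p.eval x.length) y)
    (hAB : ∀ q : List Bool, q.length ≤ x.length + p.eval x.length → (q ∈ A ↔ q ∈ B)) :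
    M.fn A x = M.fn B x := by
  obtain ⟨y, hy⟩ := hp A x
  have hy' : M.OutputsIn B x (p.eval x.length) y := by
    have := iterate_step_congr hAB (M.init x) (p.eval x.length) (by
      simp only [init, Function.update_apply]
      split_ifs <;> simp)
    rw [OutputsIn, ← this]
    exact hy
  rw [Outputs.fn_eq ⟨_, hy⟩, Outputs.fn_eq ⟨_, hy'⟩]

end OracleMachine

/-! ### Polynomial-time functions -/

variable {V V' U : Type}

/-- A string-valued function of an oracle and of finitely many strings that is computable in
polynomial time. -/
def PolyFn (G : BinLang → (V → List Bool) → List Bool) : Prop :=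
  PolyTr (V := Option V) fun A s => setAt s none (G A fun v => s (some v))

/-- The family `s` of strings, extended by `q`. -/
def scons (q : List Bool) (s : V → List Bool) : Option V → List Bool := fun o => o.elim q s

@[simp] theorem scons_none (q : List Bool) (s : V → List Bool) : scons q s none = q := rfl

@[simp] theorem scons_some (q : List Bool) (s : V → List Bool) (v : V) :
    scons q s (some v) = s v := rfl

theorem Bdd.scons {N : ℕ} {q : List Bool} {s : V → List Bool} (hq : q.length ≤ N) (hs : Bdd N s) :
    Bdd N (scons q s) := by
  rintro (_ | v)
  · exact hq
  · exact hs v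

/-- The assignment `w := G(ι v, ...)` inside a larger family of stacks; `PolyFn` keeps the result
apart from the arguments, so `w` must not be one of them. -/
theorem PolyTr.assign {G : BinLang → (V → List Bool) → List Bool} (hG : PolyFn G) {ι : V → V'}
    (hι : ι.Injective) {w : V'} (hw : ∀ v, ι v ≠ w) :
    PolyTr fun A s => setAt s w (G A fun v => s (ι v)) := by
  have hι' : (fun o : Option V => o.elim w ι).Injective := by
    rintro (_ | a) (_ | b) h
    · rfl
    · exact absurd h.symm (hw b)
    · exact absurd h (hw a)
    · exact congrArg some (hι h)
  refine PolyOp.congr (hG.reindex hι') fun A s => ?_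
  rw [Prod.mk.injEq]
  refine ⟨?_, rfl⟩
  funext j
  by_cases hj : ∃ o : Option V, o.elim w ι = j
  · obtain ⟨o, rfl⟩ := hj
    rw [hι'.extend_apply]
    rcases o with _ | v
    · simp
    · change setAt _ none _ (some v) = setAt _ _ _ (ι v)
      rw [setAt_of_ne (by simp), setAt_of_ne (hw v)]
      rfl
  · rw [Function.extend_apply' _ _ _ hj]
    refine (setAt_of_ne ?_).symm
    rintro rfl
    exact hj ⟨none, rfl⟩

namespace PolyFn

theorem congr {F G : BinLang → (V → List Bool) → List Bool} (hF : PolyFn F)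
    (h : ∀ A s, F A s = G A s) : PolyFn G := by
  have : F = G := by
    funext A s
    exact h A s
  exact this ▸ hF

theorem exists_bound {G : BinLang → (V → List Bool) → List Bool} (hG : PolyFn G) :
    ∃ p : ℕ[X], ∀ A N s, Bdd N s → (G A s).length ≤ p.eval N := by
  obtain ⟨p, hp⟩ := PolyOp.exists_bound hG
  refine ⟨p, fun A N s hs => ?_⟩
  simpa using hp A N (scons [] s) (Bdd.scons (Nat.zero_le _) hs) none

theorem of_hide [Finite U] {G : BinLang → (V → List Bool) → List Bool}
    {f : BinLang → (Option V ⊕ U → List Bool) → Option V ⊕ U → List Bool} (hf : PolyTr f)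
    (h : ∀ A s v, f A (Sum.elim s fun _ => []) (.inl v) =
      setAt s none (G A fun v => s (some v)) v) :
    PolyFn G :=
  (PolyTr.hide hf).congr h

theorem nil : PolyFn fun _ (_ : V → List Bool) => [] := PolyTr.clear none

theorem cons (b : Bool) {G : BinLang → (V → List Bool) → List Bool} (hG : PolyFn G) :
    PolyFn fun A s => b :: G A s :=
  (PolyTr.comp (PolyOp.push none b) hG).congr fun A s v => by simp

theorem const (l : List Bool) : PolyFn fun _ (_ : V → List Bool) => l := by
  induction l with
  | nil => exact nil
  | cons b l ih => exact cons b ih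

/-- Reading destroys a stack, so copying goes through a scratch stack: drain `v` into it, then drain
it back onto both `v` and the result. The two reversals cancel. -/
theorem var (v : V) : PolyFn fun _ s => s v := by
  classical
  refine of_hide (U := Unit) (PolyTr.comp (PolyTr.drain (.inr ()) [.inl none, .inl (some v)]
    (by simp) (by simp)) (PolyTr.comp (PolyTr.drain (.inl (some v)) [.inr ()] (by simp) (by simp))
      (PolyTr.clear (.inl none)))) ?_
  intro A s k
  rcases k with _ | k
  · simp [setAt_apply]
  · by_cases hk : k = v <;> simp [setAt_apply, hk]

/-- `PolyOp.ask` reverses its argument, so it is given a reversed copy. -/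
theorem query (v : V) : PolyFn fun A s => [BinLang.char A (s v)] := by
  classical
  have h1 := PolyTr.comp (PolyTr.drain (.inr true) [.inr false] (by simp) (by simp))
    (PolyTr.assign (var v) (ι := fun v => (.inl (some v) : Option V ⊕ Bool)) (w := .inr true)
      (fun a b h => by simpa using h) (by simp))
  have h2 : ∀ b, PolyTr fun _ (s : Option V ⊕ Bool → List Bool) => setAt s (.inl none) [b] :=
    fun b => (PolyTr.comp (PolyOp.push (.inl none) b) (PolyTr.clear (.inl none))).congr
      fun A s k => by simp
  refine of_hide (PolyTr.bind (PolyOp.bind h1 fun _ => PolyOp.ask (.inr false)) h2) ?_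
  intro A s k
  rcases k with _ | k <;> simp [setAt_apply]

theorem comp [Finite U] {G : BinLang → (U → List Bool) → List Bool}
    {H : U → BinLang → (V → List Bool) → List Bool} (hG : PolyFn G) (hH : ∀ u, PolyFn (H u)) :
    PolyFn fun A s => G A fun u => H u A s := by
  classical
  have := Fintype.ofFinite U
  -- The arguments are computed one by one into scratch stacks; the visible stacks stay intact for
  -- the later ones.
  have key : ∀ us : List U, PolyTr fun A (s : Option V ⊕ U → List Bool) k => match k with
      | .inl v => s (.inl v)
      | .inr u => if u ∈ us then H u A fun v => s (.inl (some v)) else s (.inr u) := by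
    intro us
    induction us with
    | nil => exact PolyTr.id.congr fun A s k => by rcases k with k | k <;> simp
    | cons u us ih =>
      refine (PolyTr.comp (PolyTr.assign (hH u) (ι := fun v => .inl (some v)) (w := .inr u)
        (fun a b h => by simpa using h) (by simp)) ih).congr fun A s k => ?_
      rcases k with k | k
      · simp [setAt_apply]
      · by_cases hk : k = u <;> simp [setAt_apply, hk]
  refine of_hide (PolyTr.comp (PolyTr.assign hG (ι := .inr) (w := .inl none) Sum.inr_injective
    (by simp)) (key Finset.univ.toList)) fun A s k => ?_
  rcases k with _ | k <;> simp [setAt_apply]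

theorem rename [Finite V] (ι : V → V') {G : BinLang → (V → List Bool) → List Bool} (hG : PolyFn G) :
    PolyFn fun A s => G A fun v => s (ι v) :=
  comp hG fun v => var (ι v)

/-- Recursion on a list, provided that the values have polynomially bounded length. -/
theorem recList [Finite V] {L G : BinLang → (V → List Bool) → List Bool}
    {H : Bool → BinLang → (Option (Option V) → List Bool) → List Bool}
    {R : BinLang → (V → List Bool) → List Bool → List Bool}
    (hL : PolyFn L) (hG : PolyFn G) (hH : ∀ b, PolyFn (H b))
    (h0 : ∀ A s, R A s [] = G A s)
    (h1 : ∀ A s b l, R A s (b :: l) = H b A (scons (R A s l) (scons l s)))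
    (p : ℕ[X]) (hp : ∀ A N s l, Bdd N s → l.length ≤ N → (R A s l).length ≤ p.eval N) :
    PolyFn fun A s => R A s (L A s) := by
  classical
  obtain ⟨r, hr⟩ := hL.exists_bound
  let vis : (Option V ⊕ Fin 4 → List Bool) → V → List Bool := fun s v => s (.inl (some v))
  -- The recursion proceeds from the end of the list, so the list is reversed first. Scratch stacks:
  -- 0 temporary, 1 the suffix already treated, 2 the value on it, 3 the bits still to come.
  let cur : BinLang → (Option V ⊕ Fin 4 → List Bool) → List Bool → List Bool →
      Option V ⊕ Fin 4 → List Bool := fun A s pre l k => match k with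
    | .inl v => s (.inl v)
    | .inr i => ![[], pre.reverse, R A (vis s) pre.reverse, l] i
  have hinj : (fun v : V => (Sum.inl (some v) : Option V ⊕ Fin 4)).Injective :=
    fun a b h => by simpa using h
  have hinit : PolyTr fun A s => cur A s [] (L A (vis s)).reverse := by
    refine (PolyTr.comp (PolyTr.assign hG hinj (w := .inr 2) (by simp))
      (PolyTr.comp (PolyTr.drain (.inr 0) [.inr 3] (by simp) (by simp))
        (PolyTr.comp (PolyTr.assign hL hinj (w := .inr 0) (by simp))
          (PolyTr.comp (PolyTr.clear (.inr 1)) (PolyTr.clear (.inr 3)))))).congr fun A s k => ?_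
    rcases k with k | k
    · simp [setAt_apply, cur]
    · fin_cases k <;> simp [setAt_apply, cur, vis, h0]
  have hbody : ∀ b, PolyTr fun A (s : Option V ⊕ Fin 4 → List Bool) k => match k with
      | .inl v => s (.inl v)
      | .inr i => ![[], b :: s (.inr 1), H b A (scons (s (.inr 2)) (scons (s (.inr 1)) (vis s))),
          s (.inr 3)] i := by
    intro b
    have hi : (fun o : Option (Option V) => match o with
        | none => (Sum.inr 2 : Option V ⊕ Fin 4)
        | some none => .inr 1
        | some (some v) => .inl (some v)).Injective := by
      rintro (_ | _ | a) (_ | _ | b) h <;> simp_all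
    refine (PolyTr.comp (PolyOp.push (.inr 1) b) (PolyTr.comp (PolyTr.clear (.inr 0))
      (PolyTr.comp (PolyTr.assign (var ()) (ι := fun _ => .inr 0) (w := .inr 2)
        (fun _ _ _ => rfl) (by simp)) (PolyTr.assign (hH b) hi (w := .inr 0) ?_)))).congr
        fun A s k => ?_
    · rintro (_ | _ | v) <;> simp
    · have e : ∀ s : Option V ⊕ Fin 4 → List Bool, (fun o : Option (Option V) => s (match o with
        | none => (Sum.inr 2 : Option V ⊕ Fin 4)
        | some none => .inr 1
        | some (some v) => .inl (some v))) = scons (s (.inr 2)) (scons (s (.inr 1)) (vis s)) := by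
        intro s
        funext o
        rcases o with _ | _ | v <;> rfl
      simp only [e]
      rcases k with k | k
      · simp [setAt_apply]
      · fin_cases k <;> simp [setAt_apply]
  refine of_hide (PolyTr.comp (PolyTr.assign (var ()) (ι := fun _ => .inr 2) (w := .inl none)
    (fun _ _ _ => rfl) (by simp)) (PolyTr.each (v := .inr 3) (cur := cur) hinit hbody
      (X + r + p.comp (X + r)) ?_ ?_ ?_ ?_)) ?_
  · intro A s
    simp [cur]
  · intro A s pre b l h
    funext k
    rcases k with k | k
    · simp [cur, setAt_apply]
    · fin_cases k <;> simp [cur, setAt_apply, h1, vis]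
  · intro A s pre l h
    rfl
  · intro A N s pre l hs h k
    have e : (L A (vis s)).reverse = pre ++ l := h
    have hl := hr A N (vis s) fun v => hs _
    have e' := congrArg List.length e
    simp only [List.length_reverse, List.length_append] at e'
    have hR := hp A (N + r.eval N) (vis s) pre.reverse (fun v => (hs _).trans (by omega))
      (by simp; omega)
    rcases k with k | k
    · have := hs (.inl k)
      simp only [cur, eval_add, eval_X, eval_comp]
      omega
    · fin_cases k <;> simp [cur] <;> omega
  · intro A s k
    rcases k with _ | k <;> simp [setAt_apply, cur, vis]

end PolyFn

/-! ### Passing between machines and polynomial-time functions -/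

namespace OracleMachine

theorem step_eq_of_exec {M : OracleMachine} {A : BinLang} {c : M.Cfg} {p : M.Q}
    {s : M.K → List Bool} (h : (M.prog c.state).exec A M.qry c.stk = some (p, s)) :
    M.step A c = ⟨p, s⟩ := by
  rw [step]
  cases hi : M.prog c.state <;> rw [hi] at h <;>
    simp_all [Instr.exec, update_eq_setAt]

end OracleMachine

namespace PolyFn

variable {V : Type}

/-- Simulation of a polynomial-time machine whose queries are answered by a polynomial-time
predicate. -/
theorem sim [Finite V] {S : OracleMachine} (hS : S.PolyTime)
    {D : BinLang → (Option V → List Bool) → Bool} {I : BinLang → (V → List Bool) → List Bool}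
    (hD : PolyFn fun A s => [D A s]) (hI : PolyFn I) :
    PolyFn fun A s => S.fn {q | D A (scons q s) = true} (I A s) := by
  classical
  have := Fintype.ofFinite S.K
  obtain ⟨p, hp⟩ := hS
  obtain ⟨r, hr⟩ := hI.exists_bound
  let vis : (Option V ⊕ Option S.K → List Bool) → V → List Bool := fun s v => s (.inl (some v))
  -- Stack `some k` holds the stack `k` of `S`, and `none` receives the answers of `D`. The state of
  -- `S` is the loop value.
  let reg : (Option V ⊕ Option S.K → List Bool) → S.Cfg →
      Option V ⊕ Option S.K → List Bool := fun s c => Sum.elim (fun v => s (.inl v)) fun o => o.elim [] c.stk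
  let B : BinLang → (Option V ⊕ Option S.K → List Bool) → BinLang := fun A s =>
    {q | D A (scons q (vis s)) = true}
  let body : S.Q → BinLang → (Option V ⊕ Option S.K → List Bool) →
      (Option V ⊕ Option S.K → List Bool) × (S.Q ⊕ Unit) :=
    fun q A s => match S.prog q with
    | .push k b next => (setAt s (.inr (some k)) (b :: s (.inr (some k))), .inl next)
    | .pop k next => (setAt s (.inr (some k)) (s (.inr (some k))).tail,
        .inl (next (s (.inr (some k))).head?))
    | .query yes no => (setAt s (.inr none) [],
        .inl (if s (.inr (some S.qry)) ∈ B A s then yes else no))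
    | .halt => (s, .inr ())
  have hbody : ∀ q, PolyOp (body q) := by
    intro q
    simp only [body]
    cases S.prog q with
    | push k b next => exact PolyTr.ret (PolyOp.push _ _) _
    | pop k next =>
      exact PolyOp.bind (E' := S.Q ⊕ Unit) (g := fun o _ s => (s, .inl (next o)))
        (PolyOp.pop _) fun o => PolyOp.ret _
    | query yes no =>
      have hi : (fun o : Option V => o.elim (.inr (some S.qry) : Option V ⊕ Option S.K)
          fun v => .inl (some v)).Injective := by
        rintro (_ | a) (_ | b) h <;> simp_all
      have ha := PolyTr.assign hD hi (w := .inr none) (by rintro (_ | v) <;> simp)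
      refine (PolyOp.bind (E' := S.Q ⊕ Unit)
        (g := fun o _ s => (s, .inl (if o = some true then yes else no)))
        (PolyOp.bind ha fun _ => PolyOp.pop (.inr none)) fun o => PolyOp.ret _).congr fun A s => ?_
      have e : (fun o : Option V => s (o.elim (.inr (some S.qry) : Option V ⊕ Option S.K)
          fun v => .inl (some v))) = scons (s (.inr (some S.qry))) (vis s) := by
        funext o
        rcases o with _ | v <;> rfl
      simp [e, B]
    | halt => exact PolyOp.ret _
  have hinit : PolyTr fun A (s : Option V ⊕ Option S.K → List Bool) =>
      reg s (S.init (I A (vis s))) := by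
    refine (PolyTr.comp (PolyTr.assign hI (ι := fun v => .inl (some v))
      (w := (.inr (some S.inp) : Option V ⊕ Option S.K)) (fun a b h => by simpa using h) (by simp))
      (PolyTr.clearAll ((Finset.univ : Finset (Option S.K)).toList.map .inr))).congr
      fun A s k => ?_
    rcases k with k | _ | k
    · simp [setAt_apply, reg]
    · simp [setAt_apply, reg]
    · by_cases hk : k = S.inp
      · subst hk
        simp [reg, OracleMachine.init, vis]
      · simp [setAt_apply, reg, OracleMachine.init, hk]
  -- One round simulates one step, and one extra round detects the halt; `S` may halt early, hence
  -- `≤`.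
  have hIter : ∀ A s N t (c : S.Cfg), (∀ k, (c.stk k).length + t ≤ N) → Bdd N s →
      S.prog ((S.step (B A s))^[t] c).state = .halt →
      ∃ n ≤ t + 1, Iter (fun q => body q A) N c.state (reg s c) n
        (reg s ((S.step (B A s))^[t] c)) () := by
    intro A s N t
    have hreg : ∀ t (c : S.Cfg), (∀ k, (c.stk k).length + t ≤ N) → Bdd N s → Bdd N (reg s c) := by
      rintro t c hc hs (v | _ | k)
      · exact hs _
      · simp [reg]
      · exact (Nat.le_add_right _ _).trans (hc k)
    induction t with
    | zero =>
      intro c hc hs hh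
      refine ⟨1, by simp, .exit (hreg _ c hc hs) ?_⟩
      simp only [Function.iterate_zero, id] at hh
      simp [body, hh]
    | succ t ih =>
      intro c hc hs hh
      by_cases hcs : S.prog c.state = .halt
      · refine ⟨1, by simp, .exit (hreg _ c hc hs) ?_⟩
        rw [OracleMachine.iterate_step_of_halt hcs]
        simp [body, hcs]
      · obtain ⟨n, hn, h⟩ := ih (S.step (B A s) c) (fun k => by
          have := S.step_length_le (A := B A s) c k
          have := hc k
          omega) hs hh
        refine ⟨n + 1, by omega, .next (hreg _ c hc hs) ?_ h⟩
        have hB : B A (reg s c) = B A s := rfl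
        simp only [body, OracleMachine.step, hB]
        cases hi : S.prog c.state with
        | push k b next =>
          refine Prod.ext ?_ rfl
          funext j
          rcases j with j | _ | j
          · simp [reg, setAt_apply]
          · simp [reg, setAt_apply]
          · by_cases hj : j = k <;> simp [reg, setAt_apply, hj]
        | pop k next =>
          refine Prod.ext ?_ rfl
          funext j
          rcases j with j | _ | j
          · simp [reg, setAt_apply]
          · simp [reg, setAt_apply]
          · by_cases hj : j = k <;> simp [reg, setAt_apply, hj]
        | query yes no =>
          refine Prod.ext ?_ ?_
          · funext j
            rcases j with j | _ | j <;> simp [reg, setAt_apply]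
          · simp only [reg, Sum.elim_inr, Option.elim_some]
            by_cases hq : c.stk S.qry ∈ B A s <;> simp [hq]
        | halt => exact absurd hi hcs
  have hloop : PolyTr fun A (s : Option V ⊕ Option S.K → List Bool) => reg s
      ((S.step (B A s))^[p.eval (I A (vis s)).length] (S.init (I A (vis s)))) := by
    refine PolyOp.loop (hinit.ret S.start) hbody (X + r + p.comp r + 1) fun A N s hs => ?_
    have hv : Bdd N (vis s) := fun v => hs _
    have hl := hr A N _ hv
    have hl' := eval_monotone p hl
    simp only [] at hl'
    obtain ⟨y, hy, -⟩ := hp (B A s) (I A (vis s))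
    obtain ⟨n, hn, h⟩ := hIter A s ((X + r + p.comp r + 1).eval N) _ (S.init (I A (vis s)))
      (fun k => by
        have : ((S.init (I A (vis s))).stk k).length ≤ (I A (vis s)).length := by
          simp only [OracleMachine.init, Function.update_apply]
          split_ifs <;> simp
        simp only [eval_add, eval_X, eval_comp, eval_one]
        omega) (hs.mono (by simp only [eval_add, eval_X, eval_comp, eval_one]; omega)) hy
    refine ⟨n, ?_, h⟩
    simp only [eval_add, eval_X, eval_comp, eval_one]
    omega
  refine of_hide (PolyTr.comp (PolyTr.assign (var ()) (ι := fun _ => .inr (some S.out))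
    (w := .inl none) (fun _ _ _ => rfl) (by simp)) hloop) fun A s k => ?_
  obtain ⟨y, hy⟩ := hp {q | D A (scons q fun v => s (some v)) = true} (I A fun v => s (some v))
  rcases k with _ | k
  · rw [OracleMachine.Outputs.fn_eq ⟨_, hy⟩]
    simp only [setAt_same]
    exact hy.2
  · simp [reg, setAt_apply]

/-- A polynomial-time function of one string is computed by a polynomial-time machine. -/
theorem exists_machine {G : BinLang → (Unit → List Bool) → List Bool} (hG : PolyFn G) :
    ∃ M : OracleMachine, M.PolyTime ∧ ∀ A x, M.fn A x = G A fun _ => x := by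
  classical
  obtain ⟨W, _, F, p, hF⟩ := hG
  let M : OracleMachine :=
    { K := Option Unit ⊕ Option W
      Q := Option F.Q
      inp := .inl (some ())
      out := .inl none
      qry := .inr none
      start := some F.start
      prog := fun q => q.elim .halt fun q => (F.prog q).mapState (Sum.elim some fun _ => none) }
  have key : ∀ A q s t s' e, F.Run A (.inr none) q s t s' e →
      (M.step A)^[t] ⟨some q, s⟩ = ⟨none, s'⟩ := by
    intro A q s t s' e h
    induction h with
    | exit h =>
      rename_i s' e
      refine OracleMachine.step_eq_of_exec ?_
      simp [M, Instr.exec_mapState, h]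
    | next h _ ih =>
      rw [Function.iterate_succ_apply, ← ih]
      congr 1
      refine OracleMachine.step_eq_of_exec ?_
      simp [M, Instr.exec_mapState, h]
  have out : ∀ A x, M.OutputsIn A x (p.eval x.length) (G A fun _ => x) := by
    intro A x
    obtain ⟨t, ht, h⟩ := hF A x.length (scons [] fun _ => x) (by rintro (_ | _) <;> simp)
    refine OracleMachine.OutputsIn.mono ?_ ht
    have h := key _ _ _ _ _ _ h
    have e : M.init x = ⟨some F.start, clean (scons [] fun _ => x)⟩ := by
      simp only [OracleMachine.init, M, OracleMachine.Cfg.mk.injEq, true_and]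
      funext k
      rcases k with (_ | _) | k <;> simp [clean]
    rw [OracleMachine.OutputsIn, e, h]
    simp [M, clean]
  exact ⟨M, ⟨p, fun A x => ⟨_, out A x⟩⟩, fun A x => OracleMachine.Outputs.fn_eq ⟨_, out A x⟩⟩

end PolyFn

theorem BinLang.char_eq_true {L : BinLang} {x : List Bool} : L.char x = true ↔ x ∈ L := by
  simp [BinLang.char]

/-! ### A stock of polynomial-time functions -/

/-- The successor in the enumeration of all strings by length, least significant bit first. -/
def strSucc : List Bool → List Bool
  | [] => [false]
  | false :: l => true :: l
  | true :: l => false :: strSucc l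

/-- The `n`-th string. -/
def strOf (n : ℕ) : List Bool := strSucc^[n] []

/-- The position of a string in the enumeration. -/
def strIndex : List Bool → ℕ
  | [] => 0
  | false :: l => 2 * strIndex l + 1
  | true :: l => 2 * strIndex l + 2

theorem strIndex_strSucc (l : List Bool) : strIndex (strSucc l) = strIndex l + 1 := by
  induction l with
  | nil => rfl
  | cons b l ih =>
    cases b
    · rfl
    · simp only [strSucc, strIndex, ih]
      omega

theorem strIndex_injective : strIndex.Injective := by
  intro l
  induction l with
  | nil => rintro (_ | ⟨_ | _, l'⟩) h <;> simp_all [strIndex]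
  | cons b l ih =>
    rintro (_ | ⟨b', l'⟩) h
    · cases b <;> simp [strIndex] at h
    · have : b = b' ∧ strIndex l = strIndex l' := by
        cases b <;> cases b' <;> simp only [strIndex] at h <;>
          first | exact ⟨rfl, by omega⟩ | omega
      rw [this.1, ih this.2]

theorem strIndex_strOf (n : ℕ) : strIndex (strOf n) = n := by
  induction n with
  | zero => rfl
  | succ n ih => rw [strOf, Function.iterate_succ_apply', strIndex_strSucc]; exact congrArg _ ih

theorem strOf_strIndex (l : List Bool) : strOf (strIndex l) = l :=
  strIndex_injective (strIndex_strOf _)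

/-- This makes strings of logarithmic length appear among polynomially many first strings. -/
theorem strIndex_lt (l : List Bool) : strIndex l + 2 ≤ 2 ^ (l.length + 1) := by
  induction l with
  | nil => simp [strIndex]
  | cons b l ih =>
    rw [List.length_cons, pow_succ]
    cases b <;> simp only [strIndex] <;> omega

theorem length_strSucc_le (l : List Bool) : (strSucc l).length ≤ l.length + 1 := by
  induction l with
  | nil => simp [strSucc]
  | cons b l ih => cases b <;> simp [strSucc, ih]

theorem length_strOf_le (n : ℕ) : (strOf n).length ≤ n := by
  induction n with
  | zero => simp [strOf]
  | succ n ih =>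
    rw [strOf, Function.iterate_succ_apply']
    exact (length_strSucc_le _).trans (Nat.succ_le_succ ih)

namespace PolyFn

variable {V : Type} [Finite V] {F G : BinLang → (V → List Bool) → List Bool}

/-- Case distinction is list recursion that ignores the recursive value. -/
theorem caseList {L : BinLang → (V → List Bool) → List Bool}
    {H : Bool → BinLang → (Option V → List Bool) → List Bool}
    (hL : PolyFn L) (hG : PolyFn G) (hH : ∀ b, PolyFn (H b)) :
    PolyFn fun A s => match L A s with
      | [] => G A s
      | b :: l => H b A (scons l s) := by
  obtain ⟨p, hp⟩ := hG.exists_bound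
  obtain ⟨q, hq⟩ := (hH true).exists_bound
  obtain ⟨r, hr⟩ := (hH false).exists_bound
  refine recList (R := fun A s l => match l with
      | [] => G A s
      | b :: l => H b A (scons l s)) hL hG
    (fun b => (hH b).rename fun o => o.elim (some none) fun v => some (some v)) ?_ ?_ (p + q + r) ?_
  · simp
  · intro A s b l
    dsimp only
    congr 1
    funext o
    rcases o with _ | v <;> rfl
  · intro A N s l hs hl
    rw [eval_add, eval_add]
    rcases l with _ | ⟨b, l⟩
    · have := hp A N s hs
      dsimp only
      omega
    · have hb : Bdd N (scons l s) :=
        Bdd.scons (by simp only [List.length_cons] at hl; omega) hs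
      have h1 := hq A N _ hb
      have h2 := hr A N _ hb
      cases b <;> dsimp only <;> omega

theorem ite {c : BinLang → (V → List Bool) → Bool} (hc : PolyFn fun A s => [c A s])
    (hF : PolyFn F) (hG : PolyFn G) : PolyFn fun A s => if c A s = true then F A s else G A s := by
  refine (caseList (H := fun b A s => if b = true then F A fun v => s (some v) else
    G A fun v => s (some v)) hc nil ?_).congr fun A s => ?_
  · rintro (_ | _)
    · simpa using hG.rename some
    · simpa using hF.rename some
  · simp

theorem not {c : BinLang → (V → List Bool) → Bool} (hc : PolyFn fun A s => [c A s]) :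
    PolyFn fun A s => [!c A s] :=
  (ite hc (const [false]) (const [true])).congr fun A s => by cases c A s <;> rfl

theorem eqTrue (hF : PolyFn F) : PolyFn fun A s => [decide (F A s = [true])] := by
  refine (caseList (H := fun b _ s => if b = true then match s none with
    | [] => [true]
    | _ :: _ => [false] else [false]) hF (const [false]) ?_).congr fun A s => ?_
  · rintro (_ | _)
    · simpa using const [false]
    · simpa using caseList (H := fun _ _ _ => [false]) (var none) (const [true])
        fun _ => const [false]
  · rcases F A s with _ | ⟨_ | _, _ | _⟩ <;> simp

theorem append (hF : PolyFn F) (hG : PolyFn G) : PolyFn fun A s => F A s ++ G A s := by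
  obtain ⟨p, hp⟩ := hG.exists_bound
  refine recList (R := fun A s l => l ++ G A s) (H := fun b _ s => b :: s none) hF hG
    (fun b => cons b (var none)) (by simp) (by simp) (X + p) fun A N s l hs hl => ?_
  have := hp A N s hs
  simp only [List.length_append, eval_add, eval_X]
  omega

theorem encodePair (hF : PolyFn F) (hG : PolyFn G) :
    PolyFn fun A s => _root_.encodePair (F A s) (G A s) := by
  obtain ⟨p, hp⟩ := hG.exists_bound
  refine recList (R := fun A s l => _root_.encodePair l (G A s))
    (H := fun b _ s => true :: b :: s none) hF (cons false hG)
    (fun b => cons true (cons b (var none))) (by simp [_root_.encodePair])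
    (by simp [_root_.encodePair]) (2 * X + p + 1) fun A N s l hs hl => ?_
  have := hp A N s hs
  have e : (_root_.encodePair l (G A s)).length = 2 * l.length + (G A s).length + 1 := by
    simp [_root_.encodePair, List.length_flatMap, mul_comm]
    omega
  simp only [e, eval_add, eval_mul, eval_ofNat, eval_X, eval_one]
  omega

/-- Numbers serve only as padding lengths and search bounds, so unary notation is affordable. -/
theorem unaryLength (hF : PolyFn F) : PolyFn fun A s => List.replicate (F A s).length true :=
  recList (R := fun _ _ l => List.replicate l.length true) (H := fun _ _ s => true :: s none) hF nil
    (fun _ => cons true (var none)) (by simp) (by simp [List.replicate_succ]) X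
    fun A N s l _ hl => by simpa using hl

theorem unaryMul {a b : BinLang → (V → List Bool) → ℕ}
    (ha : PolyFn fun A s => List.replicate (a A s) true)
    (hb : PolyFn fun A s => List.replicate (b A s) true) :
    PolyFn fun A s => List.replicate (a A s * b A s) true := by
  obtain ⟨p, hp⟩ := hb.exists_bound
  refine (recList (R := fun A s l => List.replicate (l.length * b A s) true) ha nil
    (H := fun _ A s => List.replicate (b A fun v => s (some (some v))) true ++ s none)
    (fun _ => append (hb.rename fun v => some (some v)) (var none)) (by simp) ?_ (X * p)
    fun A N s l hs hl => ?_).congr fun A s => by simp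
  · intro A s c l
    simp only [List.length_cons, scons_some, scons_none, List.replicate_append_replicate]
    congr 1
    ring
  · have := hp A N s hs
    simp only [List.length_replicate, eval_mul, eval_X] at this ⊢
    exact Nat.mul_le_mul hl this

theorem unaryEval (p : ℕ[X]) {a : BinLang → (V → List Bool) → ℕ}
    (ha : PolyFn fun A s => List.replicate (a A s) true) :
    PolyFn fun A s => List.replicate (p.eval (a A s)) true := by
  induction p using Polynomial.induction_on with
  | C c => simpa using const (List.replicate c true)
  | add p q hp hq =>
    exact (append hp hq).congr fun A s => by simp [List.replicate_append_replicate]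
  | monomial n c h => exact (unaryMul h ha).congr fun A s => by simp [pow_succ, mul_assoc]

theorem strSucc (hF : PolyFn F) : PolyFn fun A s => _root_.strSucc (F A s) := by
  refine recList (R := fun _ _ l => _root_.strSucc l)
    (H := fun b _ s => if b = true then false :: s none else true :: s (some none)) hF
    (const [false]) ?_ (fun _ _ => rfl) ?_ (X + 1) fun A N s l _ hl => ?_
  · rintro (_ | _)
    · simpa using cons true (var (some none))
    · simpa using cons false (var none)
  · rintro A s (_ | _) l <;> simp [_root_.strSucc]
  · have := length_strSucc_le l
    simp only [eval_add, eval_X, eval_one]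
    omega

theorem strOfLength (hF : PolyFn F) : PolyFn fun A s => strOf (F A s).length :=
  recList (R := fun _ _ l => strOf l.length) (H := fun _ _ s => _root_.strSucc (s none)) hF nil
    (fun _ => strSucc (var none)) (fun _ _ => rfl)
    (fun A s b l => by simp [strOf, Function.iterate_succ_apply']) X
    fun A N s l _ hl => by simpa using (length_strOf_le _).trans hl

/-- Search through the first strings, as many as the length of a given one. -/
theorem existsStr {L : BinLang → (V → List Bool) → List Bool}
    {D : BinLang → (Option V → List Bool) → Bool} {c : BinLang → (V → List Bool) → Bool}
    (hL : PolyFn L) (hD : PolyFn fun A s => [D A s])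
    (hc : ∀ A s, c A s = true ↔ ∃ i < (L A s).length, D A (scons (strOf i) s) = true) :
    PolyFn fun A s => [c A s] := by
  classical
  have hH : PolyFn (V := Option (Option V)) fun A t =>
      if D A (scons (strOf (t (some none)).length) fun v => t (some (some v))) = true then [true]
      else t none := by
    refine ite ?_ (const [true]) (var none)
    refine (comp hD (H := fun o _ t => o.elim (strOf (t (some none)).length)
      fun v => t (some (some v))) ?_).congr fun A t => ?_
    · rintro (_ | v)
      · exact strOfLength (var (some none))
      · exact var (some (some v))
    · congr 2
  refine (recList (R := fun A s l => [decide (∃ i < l.length, D A (scons (strOf i) s) = true)]) hL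
    (const [false]) (fun _ => hH) (by simp) ?_ 1 (by simp)).congr fun A s => ?_
  · intro A s b l
    change _ = if D A (scons (strOf l.length) s) = true then [true] else
      [decide (∃ i < l.length, D A (scons (strOf i) s) = true)]
    rw [List.length_cons]
    by_cases h : D A (scons (strOf l.length) s) = true
    · rw [if_pos h]
      simpa using ⟨l.length, by omega, h⟩
    · rw [if_neg h]
      congr 1
      rw [decide_eq_decide]
      constructor
      · rintro ⟨i, hi, hD⟩
        rcases Nat.lt_succ_iff_lt_or_eq.1 hi with hi | rfl
        · exact ⟨i, hi, hD⟩
        · exact absurd hD h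
      · rintro ⟨i, hi, hD⟩
        exact ⟨i, by omega, hD⟩
  · congr 1
    rw [Bool.eq_iff_iff, hc, decide_eq_true_iff]

/-- A call of a polynomial-time machine. -/
theorem call {M : OracleMachine} (hM : M.PolyTime) (hF : PolyFn F) :
    PolyFn fun A s => M.fn A (F A s) := by
  refine (sim hM (query none) hF).congr fun A s => ?_
  congr 1
  ext q
  exact BinLang.char_eq_true

theorem callEmpty {M : OracleMachine} (hM : M.PolyTime) (hF : PolyFn F) :
    PolyFn fun A s => M.fn ∅ (F A s) := by
  refine (sim (D := fun _ _ => false) hM (const [false]) hF).congr fun A s => ?_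
  simp

end PolyFn

/-! ### Selectors make logarithmic advice superfluous -/

theorem joinOracle_congr {A A' B : BinLang} {N : ℕ}
    (h : ∀ q : List Bool, q.length ≤ N → (q ∈ A ↔ q ∈ A')) (q : List Bool) (hq : q.length ≤ N) :
    (q ∈ joinOracle A B ↔ q ∈ joinOracle A' B) ∧ (q ∈ joinOracle B A ↔ q ∈ joinOracle B A') := by
  rcases q with _ | ⟨_ | _, q⟩
  · simp [joinOracle]
  · simp [joinOracle, h q (by simp only [List.length_cons] at hq; omega)]
  · simp [joinOracle, h q (by simp only [List.length_cons] at hq; omega)]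

section Candidates

variable (M PD S : OracleMachine) (p : ℕ[X])

/-- The oracle that pads a string to length `m` and runs `M` on it with advice `a`. -/
def candidate (R : BinLang) (m : ℕ) (a : List Bool) : BinLang :=
  {q | M.fn R (encodePair (PD.fn ∅ (encodePair q (List.replicate m true))) a) = [true]}

/-- Membership in the join of two candidates; the variables are the query, the two advice strings
and the input. -/
noncomputable def joinCandidates (R : BinLang)
    (s : Option (Option (Option Unit)) → List Bool) : Bool :=
  match s none with
  | [] => false
  | i :: q => decide (M.fn R (encodePair (PD.fn ∅ (encodePair q
      (List.replicate (p.eval (s (some (some (some ())))).length) true)))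
      (if i = true then s (some none) else s (some (some none)))) = [true])

variable {M PD S}

theorem polyFn_joinCandidates (hM : M.PolyTime) (hPD : PD.PolyTime) :
    PolyFn fun R s => [joinCandidates M PD p R s] := by
  have h : ∀ i : Bool, PolyFn (V := Option (Option (Option (Option Unit)))) fun R s =>
      [decide (M.fn R (encodePair (PD.fn ∅ (encodePair (s none) (List.replicate
        (p.eval (s (some (some (some (some ()))))).length) true)))
        (if i = true then s (some (some none)) else s (some (some (some none))))) = [true])] := by
    intro i
    refine PolyFn.eqTrue (PolyFn.call hM (PolyFn.encodePair (PolyFn.callEmpty hPD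
      (PolyFn.encodePair (PolyFn.var none) (PolyFn.unaryEval p
        (PolyFn.unaryLength (PolyFn.var _))))) ?_))
    cases i
    · simpa using PolyFn.var _
    · simpa using PolyFn.var _
  refine (PolyFn.caseList (PolyFn.var none) (PolyFn.const [false]) h).congr fun R s => ?_
  rw [joinCandidates]
  cases s none <;> rfl

/-- The variables are nested as in the double search: `a` comes from the outer search, `b` from the
inner one. -/
theorem joinCandidates_eq (R : BinLang) (x a b : List Bool) :
    {q | joinCandidates M PD p R (scons q (scons b (scons a fun _ => x))) = true} =
      joinOracle (candidate M PD R (p.eval x.length) a) (candidate M PD R (p.eval x.length) b) := by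
  ext q
  rcases q with _ | ⟨_ | _, q⟩ <;> simp [joinCandidates, joinOracle, candidate]

end Candidates

theorem mem_PRel_iff {R L : BinLang} :
    L ∈ PRel R ↔ ∃ M : OracleMachine, M.PolyTime ∧ ∀ x, M.fn R x = [L.char x] := by
  constructor
  · rintro ⟨M, hM, h⟩
    exact ⟨M, hM, fun x => (h x).fn_eq⟩
  · rintro ⟨M, hM, h⟩
    exact ⟨M, hM, fun x => hM.outputs_iff.2 (h x)⟩

theorem mem_PRel_of_decides {R L : BinLang} {c : BinLang → (Unit → List Bool) → Bool}
    (hc : PolyFn fun A s => [c A s]) (h : ∀ x, c R (fun _ => x) = true ↔ x ∈ L) : L ∈ PRel R := by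
  obtain ⟨M, hM, h'⟩ := hc.exists_machine
  refine mem_PRel_iff.2 ⟨M, hM, fun x => ?_⟩
  rw [h', List.cons.injEq, Bool.eq_iff_iff, h, BinLang.char_eq_true]
  simp

theorem mem_PRel_of_selector {L : BinLang} (hL : Paddable L) {S : OracleMachine}
    (hS : IsDetSelector S L) {R : BinLang} (hR : L ∈ PRelLog R) : L ∈ PRel R := by
  classical
  obtain ⟨PD, -, hPD, hpad⟩ := hL
  obtain ⟨M, α, c, hM, hα, hMR⟩ := hR
  obtain ⟨hSt, hsel⟩ := hS
  obtain ⟨r, hr⟩ := id hSt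
  -- `p` bounds the queries of `S`, and its value is the common padding length.
  set p : ℕ[X] := X + r with hp
  -- With `m` the value of `p`, advice of length at most `c * (Nat.log 2 m + 1)` has index below
  -- this, because `2 ^ (Nat.log 2 m + 1) ≤ 2 * m + 2`; the outer factor 2 comes from `strIndex_lt`.
  set J : ℕ[X] := 2 * (2 * p + 2) ^ c with hJ
  have hcand : ∀ x : List Bool, ∀ q : List Bool, q.length ≤ p.eval x.length →
      (q ∈ candidate M PD R (p.eval x.length) (α (p.eval x.length)) ↔ q ∈ L) := by
    intro x q hq
    obtain ⟨y, hy, hy', hyL⟩ := hpad q _ hq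
    rw [candidate, Set.mem_ofPred_eq, hy.fn_eq, ← hyL, ← BinLang.char_eq_true, ← hy',
      (hMR y).fn_eq]
    simp
  have hrow : ∀ (x b : List Bool),
      S.fn (joinOracle (candidate M PD R (p.eval x.length) (α (p.eval x.length)))
        (candidate M PD R (p.eval x.length) b)) x = [L.char x] := by
    intro x b
    rw [← ((hsel (candidate M PD R (p.eval x.length) b)).1 x).fn_eq]
    refine OracleMachine.fn_congr hr fun q hq => (joinOracle_congr (hcand x) q ?_).1
    simpa [hp] using hq
  have hcol : ∀ (x a : List Bool),
      S.fn (joinOracle (candidate M PD R (p.eval x.length) a)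
        (candidate M PD R (p.eval x.length) (α (p.eval x.length)))) x = [L.char x] := by
    intro x a
    rw [← ((hsel (candidate M PD R (p.eval x.length) a)).2 x).fn_eq]
    refine OracleMachine.fn_congr hr fun q hq => (joinOracle_congr (hcand x) q ?_).2
    simpa [hp] using hq
  have hidx : ∀ x : List Bool, strIndex (α (p.eval x.length)) < J.eval x.length := by
    intro x
    have h1 := strIndex_lt (α (p.eval x.length))
    have h2 := hα (p.eval x.length)
    set m := p.eval x.length
    have h3 : 2 ^ ((α m).length + 1) ≤ 2 * (2 * m + 2) ^ c := by
      rw [pow_succ, mul_comm]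
      refine Nat.mul_le_mul_left 2 ?_
      calc 2 ^ (α m).length ≤ 2 ^ (c * (Nat.log 2 m + 1)) := Nat.pow_le_pow_right (by simp) h2
        _ = (2 ^ (Nat.log 2 m + 1)) ^ c := by rw [← pow_mul, mul_comm]
        _ ≤ (2 * m + 2) ^ c := by
          refine Nat.pow_le_pow_left ?_ c
          rw [pow_succ]
          -- At `m = 0` the logarithm is 0 by convention and the left side is 2, hence the summand
          -- 2.
          rcases Nat.eq_zero_or_pos m with hm | hm
          · simp [hm]
          · have := Nat.pow_log_le_self 2 hm.ne'
            omega
    have h4 : J.eval x.length = 2 * (2 * m + 2) ^ c := by simp [hJ, m]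
    omega
  have hJu : ∀ (V : Type) [Finite V] (v : V), PolyFn fun (_ : BinLang) (s : V → List Bool) =>
      List.replicate (J.eval (s v).length) true := fun V _ v =>
    PolyFn.unaryEval J (PolyFn.unaryLength (PolyFn.var v))
  -- The test "some row consists of ones" is built from two bounded searches, with "for all" as a
  -- negated search for a counterexample.
  have h1 : PolyFn (V := Option (Option Unit)) fun A s =>
      [!decide (S.fn {q | joinCandidates M PD p A (scons q s) = true} (s (some (some ()))) =
        [true])] :=
    (PolyFn.eqTrue (PolyFn.sim hSt (polyFn_joinCandidates p hM hPD) (PolyFn.var _))).not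
  have h2 : PolyFn (V := Option Unit) fun A s =>
      [!decide (∃ i < J.eval (s (some ())).length,
        (!decide (S.fn {q | joinCandidates M PD p A (scons q (scons (strOf i) s)) = true}
          (s (some ())) = [true])) = true)] :=
    (PolyFn.existsStr (hJu _ (some ())) h1 fun A s => by
      rw [decide_eq_true_iff, List.length_replicate]
      exact Iff.rfl).not
  have h3 : PolyFn (V := Unit) fun A s =>
      [decide (∃ j < J.eval (s ()).length,
        (!decide (∃ i < J.eval (s ()).length,
          (!decide (S.fn {q | joinCandidates M PD p A
            (scons q (scons (strOf i) (scons (strOf j) s))) = true} (s ()) = [true])) = true)) =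
            true)] :=
    PolyFn.existsStr (hJu _ ()) h2 fun A s => by
      rw [decide_eq_true_iff, List.length_replicate]
      exact Iff.rfl
  refine mem_PRel_of_decides h3 fun x => ?_
  simp only [decide_eq_true_eq, Bool.not_eq_true', decide_eq_false_iff_not, not_exists, not_and,
    not_not, joinCandidates_eq]
  constructor
  -- A row of ones is evaluated in the correct column, where the entry is `L(x)`.
  · rintro ⟨j, -, hj⟩
    have := hj _ (hidx x)
    rw [strOf_strIndex, hcol] at this
    exact BinLang.char_eq_true.1 (by simpa using this)
  · intro hx
    refine ⟨_, hidx x, fun i _ => ?_⟩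
    rw [strOf_strIndex, hrow, BinLang.char_eq_true.2 hx]

/-! ### Machines up to renaming of states and stacks -/

namespace Instr

theorem countable (K Q : Type) [Finite K] [Finite Q] : Countable (Instr K Q) := by
  let f : Instr K Q → (K × Bool × Q) ⊕ (K × (Option Bool → Q)) ⊕ (Q × Q) ⊕ Unit := fun i =>
    match i with
    | .push k b next => .inl (k, b, next)
    | .pop k next => .inr (.inl (k, next))
    | .query yes no => .inr (.inr (.inl (yes, no)))
    | .halt => .inr (.inr (.inr ()))
  have hf : f.Injective := by
    rintro (_ | _ | _ | _) (_ | _ | _ | _) h <;> simp_all [f]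
  exact hf.countable

end Instr

namespace OracleMachine

/-- Rename the states and the stacks of a machine. -/
def reindex (M : OracleMachine) {K Q : Type} [DecidableEq K] [Finite K] [Finite Q] (eK : M.K ≃ K)
    (eQ : M.Q ≃ Q) : OracleMachine where
  K := K
  Q := Q
  inp := eK M.inp
  out := eK M.out
  qry := eK M.qry
  start := eQ M.start
  prog q := ((M.prog (eQ.symm q)).mapStack eK).mapState eQ

theorem fn_reindex (M : OracleMachine) {K Q : Type} [DecidableEq K] [Finite K] [Finite Q]
    (eK : M.K ≃ K) (eQ : M.Q ≃ Q) : (M.reindex eK eQ).fn = M.fn := by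
  let φ : M.Cfg → (M.reindex eK eQ).Cfg := fun c => ⟨eQ c.state, fun k => c.stk (eK.symm k)⟩
  have hupd : ∀ (s : M.K → List Bool) (k : M.K) (l : List Bool),
      (fun j => Function.update s k l (eK.symm j)) =
        Function.update (fun j => s (eK.symm j)) (eK k) l := by
    intro s k l
    funext j
    simp only [Function.update_apply, Equiv.symm_apply_eq]
  have hstep : ∀ A c, (M.reindex eK eQ).step A (φ c) = φ (M.step A c) := by
    intro A c
    have hp : (M.reindex eK eQ).prog (φ c).state =
        ((M.prog c.state).mapStack eK).mapState eQ := by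
      simp [reindex, φ]
    rw [step, step, hp]
    cases hi : M.prog c.state with
    | push k b next =>
      simp only [Instr.mapStack, Instr.mapState, φ, Equiv.symm_apply_apply]
      exact congrArg (Cfg.mk (M := M.reindex eK eQ) (eQ next)) (hupd c.stk k _).symm
    | pop k next =>
      simp only [Instr.mapStack, Instr.mapState, φ, Function.comp, Equiv.symm_apply_apply]
      exact congrArg (Cfg.mk (M := M.reindex eK eQ) _) (hupd c.stk k _).symm
    | query yes no =>
      have hq : (φ c).stk (M.reindex eK eQ).qry = c.stk M.qry := by simp [φ, reindex]
      simp only [Instr.mapStack, Instr.mapState]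
      by_cases h : c.stk M.qry ∈ A
      · rw [if_pos h]
        exact congrArg (fun q => Cfg.mk (M := M.reindex eK eQ) q _) (if_pos (hq.symm ▸ h))
      · rw [if_neg h]
        exact congrArg (fun q => Cfg.mk (M := M.reindex eK eQ) q _) (if_neg (hq.symm ▸ h))
    | halt => rfl
  have hiter : ∀ A t c, ((M.reindex eK eQ).step A)^[t] (φ c) = φ ((M.step A)^[t] c) := by
    intro A t
    induction t with
    | zero => simp
    | succ t ih =>
      intro c
      rw [Function.iterate_succ_apply, Function.iterate_succ_apply, hstep, ih]
  have hinit : ∀ x, (M.reindex eK eQ).init x = φ (M.init x) := fun x =>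
    congrArg (Cfg.mk (M := M.reindex eK eQ) (eQ M.start)) (hupd (fun _ => []) M.inp x).symm
  have hout : ∀ A x y, (M.reindex eK eQ).Outputs A x y ↔ M.Outputs A x y := by
    intro A x y
    refine exists_congr fun t => and_congr ?_ ?_
    · rw [hinit, hiter]
      simp only [reindex, φ, Equiv.symm_apply_apply]
      cases M.prog ((M.step A)^[t] (M.init x)).state <;> simp [Instr.mapStack, Instr.mapState]
    · rw [hinit, hiter]
      simp [reindex, φ]
  funext A x
  by_cases h : ∃ y, M.Outputs A x y
  · obtain ⟨y, hy⟩ := h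
    rw [hy.fn_eq, ((hout A x y).2 hy).fn_eq]
  · rw [fn, fn, dif_neg h, dif_neg fun ⟨y, hy⟩ => h ⟨y, (hout A x y).1 hy⟩]

/-- Stacks and states of a machine are arbitrary finite types, so functions are counted instead of
machines; up to renaming, the types are `Fin k` and `Fin q`. -/
theorem countable_range_fn : (Set.range OracleMachine.fn).Countable := by
  let Code := Σ (k : ℕ) (q : ℕ), Fin k × Fin k × Fin k × Fin q × (Fin q → Instr (Fin k) (Fin q))
  have : ∀ k q : ℕ, Countable (Instr (Fin k) (Fin q)) := fun k q => Instr.countable _ _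
  have : Countable Code := inferInstance
  let f : Code → BinLang → List Bool → List Bool := fun c =>
    fn ⟨Fin c.1, Fin c.2.1, c.2.2.1, c.2.2.2.1, c.2.2.2.2.1, c.2.2.2.2.2.1, c.2.2.2.2.2.2⟩
  refine (Set.countable_range f).mono ?_
  rintro _ ⟨M, rfl⟩
  obtain ⟨k, ⟨eK⟩⟩ := Finite.exists_equiv_fin M.K
  obtain ⟨q, ⟨eQ⟩⟩ := Finite.exists_equiv_fin M.Q
  rw [← fn_reindex M eK eQ]
  exact ⟨⟨k, q, eK M.inp, eK M.out, eK M.qry, eQ M.start, (M.reindex eK eQ).prog⟩, rfl⟩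

end OracleMachine

/-! ### Finite changes of the oracle -/

/-- The oracle that agrees with `R` on strings shorter than `n`, and with `A` on the others. -/
def patch (n : ℕ) (R A : BinLang) : BinLang :=
  {q | (q.length < n ∧ q ∈ R) ∨ (n ≤ q.length ∧ q ∈ A)}

theorem mem_patch_of_lt {n : ℕ} {R A : BinLang} {q : List Bool} (h : q.length < n) :
    q ∈ patch n R A ↔ q ∈ R := by
  simp [patch, h]

theorem mem_patch_of_le {n : ℕ} {R A : BinLang} {q : List Bool} (h : n ≤ q.length) :
    q ∈ patch n R A ↔ q ∈ A := by
  simp [patch, h]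

/-- An arbitrary `φ` is allowed, since only its values on finitely many strings matter: they form a
table, read by `n` nested case distinctions. -/
theorem PolyFn.ite_length_lt (n : ℕ) : ∀ {V : Type} [Finite V]
    {L G : BinLang → (V → List Bool) → List Bool} (_ : PolyFn L) (_ : PolyFn G)
    (φ : List Bool → List Bool),
    PolyFn fun A s => if (L A s).length < n then φ (L A s) else G A s := by
  induction n with
  | zero => intro V _ L G _ hG φ; simpa using hG
  | succ n ih =>
    intro V _ L G hL hG φ
    refine (caseList hL (const (φ []))
      fun b => ih (var none) (hG.rename some) fun l => φ (b :: l)).congr fun A s => ?_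
    cases L A s with
    | nil => simp
    | cons b l =>
      simp only [List.length_cons, Nat.add_lt_add_iff_right]
      rfl

theorem OracleMachine.exists_patched {M : OracleMachine} (hM : M.PolyTime) (n : ℕ) (R : BinLang) :
    ∃ S : OracleMachine, S.PolyTime ∧ ∀ A x, S.fn A x = M.fn (patch n R A) x := by
  have hD : PolyFn (V := Option Unit) fun A s => [(patch n R A).char (s none)] := by
    refine (PolyFn.ite_length_lt n (PolyFn.var none) (PolyFn.query none)
      fun q => [R.char q]).congr fun A s => ?_
    split_ifs with h
    · rw [List.cons.injEq, Bool.eq_iff_iff]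
      simp [BinLang.char_eq_true, mem_patch_of_lt h]
    · rw [List.cons.injEq, Bool.eq_iff_iff]
      simp [BinLang.char_eq_true, mem_patch_of_le (not_lt.1 h)]
  obtain ⟨S, hS, h⟩ := (PolyFn.sim hM hD (PolyFn.var ())).exists_machine
  refine ⟨S, hS, fun A x => ?_⟩
  rw [h]
  congr 1
  ext q
  exact BinLang.char_eq_true

/-! ### Reading a pair whose second component is one bit -/

/-- The last bit of a string, if there is one. -/
def lastBit : List Bool → List Bool
  | [] => []
  | b :: l => match l with
    | [] => [b]
    | _ :: _ => lastBit l

/-- The bits that are followed by a positive even number of bits. -/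
def evenBits : List Bool → List Bool
  | [] => []
  | b :: l => if l ≠ [] ∧ Even l.length then b :: evenBits l else evenBits l

theorem lastBit_encodePair (x : List Bool) (b : Bool) : lastBit (encodePair x [b]) = [b] := by
  have h : ∀ c l, l ≠ [] → lastBit (c :: l) = lastBit l := by
    rintro c (_ | ⟨d, l⟩) hl
    · exact absurd rfl hl
    · rfl
  induction x with
  | nil => rfl
  | cons c x ih =>
    have e : encodePair (c :: x) [b] = true :: c :: encodePair x [b] := by simp [encodePair]
    rw [e, h _ _ (by simp), h _ _ (by simp [encodePair]), ih]

/-- Counting from the end, a bit of `x` is followed by at least two and evenly many bits, the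
markers and the separator by oddly many, and `b` by none. -/
theorem evenBits_encodePair (x : List Bool) (b : Bool) : evenBits (encodePair x [b]) = x := by
  induction x with
  | nil => simp [encodePair, evenBits]
  | cons c x ih =>
    have e : encodePair (c :: x) [b] = true :: c :: encodePair x [b] := by simp [encodePair]
    have h1 : encodePair x [b] ≠ [] := by simp [encodePair]
    have h2 : Even (encodePair x [b]).length := by
      have : (encodePair x [b]).length = 2 * (x.length + 1) := by
        simp [encodePair, List.length_flatMap]
        ring
      exact this ▸ even_two_mul _
    have h3 : evenBits (c :: encodePair x [b]) = c :: evenBits (encodePair x [b]) := by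
      rw [evenBits, if_pos ⟨h1, h2⟩]
    rw [e, evenBits, if_neg, h3, ih]
    rintro ⟨-, h⟩
    rw [List.length_cons, Nat.even_add_one] at h
    exact h h2

namespace PolyFn

variable {V : Type} [Finite V] {F : BinLang → (V → List Bool) → List Bool}

theorem lastBit (hF : PolyFn F) : PolyFn fun A s => _root_.lastBit (F A s) := by
  refine recList (R := fun _ _ l => _root_.lastBit l) (H := fun b _ s => match s (some none) with
    | [] => [b]
    | _ :: _ => s none) hF nil (fun b => caseList (H := fun _ _ s => s (some none))
      (var (some none)) (const [b]) fun _ => var (some none)) (by simp [_root_.lastBit]) ?_ X ?_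
  · rintro A s b (_ | ⟨c, l⟩) <;> rfl
  · intro A N s l _ hl
    have : ∀ l, (_root_.lastBit l).length ≤ l.length := by
      intro l
      induction l with
      | nil => simp [_root_.lastBit]
      | cons b l ih => rcases l with _ | ⟨c, l⟩ <;> simp_all [_root_.lastBit]; omega
    simpa using (this l).trans hl

theorem evenLength (hF : PolyFn F) : PolyFn fun A s => [decide (Even (F A s).length)] := by
  refine recList (R := fun _ _ l => [decide (Even l.length)])
    (H := fun _ _ s => [!decide (s none = [true])]) hF (const [true])
    (fun _ => (eqTrue (var none)).not) (by simp) ?_ 1 (by simp)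
  intro A s b l
  simp [Nat.even_add_one, -Nat.not_even_iff_odd]

theorem evenBits (hF : PolyFn F) : PolyFn fun A s => _root_.evenBits (F A s) := by
  have hc : PolyFn (V := Option (Option V)) fun _ s =>
      [decide (s (some none) ≠ [] ∧ Even (s (some none)).length)] := by
    refine (caseList (H := fun _ _ s => [decide (Even (s (some (some none))).length)])
      (var (some none)) (const [false]) fun _ => evenLength (var _)).congr fun A s => ?_
    cases h : s (some none) <;> simp [h]
  refine recList (R := fun _ _ l => _root_.evenBits l) (H := fun b _ s =>
    if decide (s (some none) ≠ [] ∧ Even (s (some none)).length) = true then b :: s none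
    else s none) hF nil (fun b => ite hc (cons b (var none)) (var none)) (by simp [_root_.evenBits])
    ?_ X ?_
  · intro A s b l
    rw [_root_.evenBits]
    by_cases h : l ≠ [] ∧ Even l.length
    · rw [if_pos h]
      exact (if_pos (decide_eq_true h)).symm
    · rw [if_neg h]
      exact (if_neg fun h' => h (of_decide_eq_true h')).symm
  · intro A N s l _ hl
    have : ∀ l, (_root_.evenBits l).length ≤ l.length := by
      intro l
      induction l with
      | nil => simp [_root_.evenBits]
      | cons b l ih =>
        rw [_root_.evenBits]
        split_ifs <;> simp <;> omega
    simpa using (this l).trans hl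

end PolyFn

/-- An oracle that decides `L` when the queries are preceded by a bit that depends only on the
length puts `L` into `PRelLog`. -/
theorem mem_PRelLog_of_bits {L R : BinLang} (b : ℕ → Bool)
    (h : ∀ x : List Bool, b x.length :: x ∈ R ↔ x ∈ L) : L ∈ PRelLog R := by
  -- The machine turns the pair of `x` and an advice bit `b` into the query `b :: x`.
  obtain ⟨M, hM, hMfn⟩ := PolyFn.exists_machine (PolyFn.comp (U := Unit)
    (PolyFn.query ()) fun _ => PolyFn.append (PolyFn.lastBit (PolyFn.var ()))
      (PolyFn.evenBits (PolyFn.var ())))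
  refine ⟨M, fun n => [b n], 1, hM, fun n => by simp, fun x => hM.outputs_iff.2 ?_⟩
  rw [hMfn, lastBit_encodePair, evenBits_encodePair, List.cons.injEq, Bool.eq_iff_iff,
    BinLang.char_eq_true, BinLang.char_eq_true]
  exact ⟨h x, rfl⟩

/-! ### Diagonalization against the absence of a selector -/

/-- One stage of the diagonalization: `R` is kept below `n`, continued by a join containing `L`, and
`M` errs with every oracle that agrees with the result below `n'`. -/
theorem exists_extension {L : BinLang} (hL : ¬ ∃ S, IsDetSelector S L) {M : OracleMachine}
    (hM : M.PolyTime) (n : ℕ) (R : BinLang) :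
    ∃ (n' : ℕ) (R' : BinLang) (b : Bool), n < n' ∧
      (∀ q : List Bool, q.length < n → (q ∈ R' ↔ q ∈ R)) ∧
      (∀ q : List Bool, n ≤ q.length + 1 → (b :: q ∈ R' ↔ q ∈ L)) ∧
      ∃ x, ∀ R'' : BinLang, (∀ q : List Bool, q.length < n' → (q ∈ R'' ↔ q ∈ R')) →
        M.fn R'' x ≠ [L.char x] := by
  obtain ⟨S, hS, hSM⟩ := OracleMachine.exists_patched hM n R
  obtain ⟨p, hp⟩ := id hM
  have key : ∀ (B : BinLang) (b : Bool), (∀ q, b :: q ∈ B ↔ q ∈ L) → ¬ S.Decides B L →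
      -- Here `B` is the join on which the patched machine errs, and `b` marks its half that is `L`.
      ∃ (n' : ℕ) (R' : BinLang) (b : Bool), n < n' ∧
        (∀ q : List Bool, q.length < n → (q ∈ R' ↔ q ∈ R)) ∧
        (∀ q : List Bool, n ≤ q.length + 1 → (b :: q ∈ R' ↔ q ∈ L)) ∧
        ∃ x, ∀ R'' : BinLang, (∀ q : List Bool, q.length < n' → (q ∈ R'' ↔ q ∈ R')) →
          M.fn R'' x ≠ [L.char x] := by
    intro B b hB hSB
    rw [OracleMachine.Decides, not_forall] at hSB
    obtain ⟨x, hx⟩ := hSB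
    rw [hS.outputs_iff, hSM] at hx
    -- The new length exceeds that of every query of `M` on `x`, so the error persists.
    refine ⟨n + (x.length + p.eval x.length) + 1, patch n R B, b, by omega,
      fun q hq => mem_patch_of_lt hq,
      fun q hq => (mem_patch_of_le (by simpa using hq)).trans (hB q), x, fun R'' hR'' => ?_⟩
    rwa [OracleMachine.fn_congr hp fun q hq => hR'' q (by omega)]
  have : ∃ X, ¬ (S.Decides (joinOracle L X) L ∧ S.Decides (joinOracle X L) L) := by
    by_contra hX
    push Not at hX
    exact hL ⟨S, hS, hX⟩
  obtain ⟨X, hX⟩ := this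
  rw [not_and_or] at hX
  rcases hX with hX | hX
  · exact key _ false (by simp [joinOracle]) hX
  · exact key _ true (by simp [joinOracle]) hX

theorem exists_between_strictMono {f : ℕ → ℕ} (hf : StrictMono f) (h0 : f 0 = 0) (m : ℕ) :
    ∃ i, f i ≤ m ∧ m < f (i + 1) := by
  induction m with
  | zero => exact ⟨0, h0.le, (Nat.zero_le _).trans_lt (hf Nat.zero_lt_one)⟩
  | succ m ih =>
    obtain ⟨i, h1, h2⟩ := ih
    by_cases h : m + 1 < f (i + 1)
    · exact ⟨i, by omega, h⟩
    · exact ⟨i + 1, by omega, lt_of_le_of_lt (by omega) (hf (Nat.lt_succ_self (i + 1)))⟩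

theorem exists_selector_of_forall {L : BinLang} (h : ∀ R : BinLang, L ∈ PRelLog R → L ∈ PRel R) :
    ∃ S : OracleMachine, IsDetSelector S L := by
  by_contra hL
  let T : Set (BinLang → List Bool → List Bool) := OracleMachine.fn '' {M | M.PolyTime}
  have hT : T.Countable := OracleMachine.countable_range_fn.mono (Set.image_subset_range _ _)
  have hTne : T.Nonempty := by
    obtain ⟨M, hM, -⟩ := (PolyFn.nil (V := Unit)).exists_machine
    exact ⟨_, M, hM, rfl⟩
  obtain ⟨e, he⟩ := hT.exists_eq_range hTne
  have hext : ∀ (i n : ℕ) (R : BinLang), ∃ (n' : ℕ) (R' : BinLang) (b : Bool), n < n' ∧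
      (∀ q : List Bool, q.length < n → (q ∈ R' ↔ q ∈ R)) ∧
      (∀ q : List Bool, n ≤ q.length + 1 → (b :: q ∈ R' ↔ q ∈ L)) ∧
      ∃ x, ∀ R'' : BinLang, (∀ q : List Bool, q.length < n' → (q ∈ R'' ↔ q ∈ R')) →
        e i R'' x ≠ [L.char x] := by
    intro i n R
    obtain ⟨M, hM, hMi⟩ : e i ∈ T := he ▸ Set.mem_range_self i
    rw [← hMi]
    exact exists_extension hL hM n R
  choose N Rn b hN hR hb hx using hext
  -- A stage consists of the length below which the oracle is frozen and the current oracle.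
  let st : ℕ → ℕ × BinLang := fun i => Nat.rec (0, ∅) (fun i s => (N i s.1 s.2, Rn i s.1 s.2)) i
  have hmono : StrictMono fun i => (st i).1 := strictMono_nat_of_lt_succ fun i => hN i _ _
  have hagree : ∀ i j, i ≤ j → ∀ q : List Bool, q.length < (st i).1 →
      (q ∈ (st j).2 ↔ q ∈ (st i).2) := by
    intro i j hij
    induction j, hij using Nat.le_induction with
    | base => simp
    | succ j hij ih =>
      intro q hq
      exact (hR j _ _ q (hq.trans_le (hmono.monotone hij))).trans (ih q hq)
  -- The frozen length grows at every stage, so `q` is settled by stage `q.length + 1`.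
  let R : BinLang := {q | q ∈ (st (q.length + 1)).2}
  have hRst : ∀ i, ∀ q : List Bool, q.length < (st i).1 → (q ∈ R ↔ q ∈ (st i).2) := by
    intro i q hq
    have hq' : q.length < (st (q.length + 1)).1 := hmono.le_apply (x := q.length + 1)
    rcases le_total i (q.length + 1) with hi | hi
    · exact hagree _ _ hi q hq
    · exact (hagree _ _ hi q hq').symm
  have hlog : L ∈ PRelLog R := by
    have hbit : ∀ m : ℕ, ∃ c : Bool, ∀ x : List Bool, x.length = m → (c :: x ∈ R ↔ x ∈ L) := by
      intro m
      -- Queries `c :: x` have length `m + 1`; the stage that froze this length supplies the advice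
      -- bit.
      obtain ⟨i, h1, h2⟩ := exists_between_strictMono hmono rfl (m + 1)
      refine ⟨b i (st i).1 (st i).2, ?_⟩
      rintro x rfl
      exact (hRst (i + 1) _ (by simpa using h2)).trans (hb i _ _ x h1)
    choose c hc using hbit
    exact mem_PRelLog_of_bits c fun x => hc _ x rfl
  obtain ⟨M, hM, hMR⟩ := mem_PRel_iff.1 (h R hlog)
  obtain ⟨i, hi⟩ : M.fn ∈ Set.range e := he ▸ ⟨M, hM, rfl⟩
  obtain ⟨x, hx⟩ := hx i (st i).1 (st i).2
  exact hx R (hRst (i + 1)) (hi ▸ hMR x)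

theorem mainTheorem6 (L : BinLang) (hL : Paddable L) :
    (∃ S : OracleMachine, IsDetSelector S L) ↔
      ∀ R : BinLang, L ∈ PRelLog R → L ∈ PRel R :=
  ⟨fun ⟨_, hS⟩ _ hR => mem_PRel_of_selector hL hS hR, exists_selector_of_forall⟩
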